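/- Let $r\ge 1$ and let $A,R,S$ be real $r\times r$ matrices with $R,S$ positive semi-definite, and let $R^{1/2},S^{1/2}$ be symmetric square roots of $R,S$ (any choice). Assume that $(A,R^{1/2})$ and $(A',S^{1/2})$ are controllable, i.e. the $r\times r^2$ matrices $[R^{1/2},AR^{1/2},\ldots,A^{r-1}R^{1/2}]$ and $[S^{1/2},A'S^{1/2},\ldots,(A')^{r-1}S^{1/2}]$ have rank $r$, where $'$ denotes transposition. Write $\mathrm{Ricc}(P):=AP+PA'+R-PSP$, let $\|\cdot\|$ be the Euclidean norm of vectors and the spectral norm of matrices, and let $\lambda_{\min}$ denote the minimal eigenvalue of a symmetric matrix. Then the following hold. (i) There are a unique positive definite matrix $P_\infty$ and a unique negative definite matrix $P_\infty^-$ with $\mathrm{Ricc}(P_\infty)=0=\mathrm{Ricc}(P_\infty^-)$. (ii) For every positive semi-definite $Q$, the equation $\partial_t\phi_t(Q)=\mathrm{Ricc}(\phi_t(Q))$, $\phi_0(Q)=Q$, and then the equation $\partial_t\mathcal E_t(Q)=(A-\phi_t(Q)S)\,\mathcal E_t(Q)$, $\mathcal E_0(Q)=I$, have unique solutions on $[0,\infty)$.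 For $x\in\mathbb R^r$, the mean flow $\widehat X_t(x,Q):=\mathcal E_t(Q)x$ is the unique solution on $[0,\infty)$ of $\partial_t\widehat X_t=(A-\phi_t(Q)S)\widehat X_t$, $\widehat X_0=x$. (iii) Set, for $t\ge 0$, $$\Delta_t:=\int_0^t e^{s(A-P_\infty S)'}S\,e^{s(A-P_\infty S)}\,ds,\qquad \Delta_\infty:=\int_0^\infty e^{s(A-P_\infty S)'}S\,e^{s(A-P_\infty S)}\,ds .$$ The last integral converges absolutely, $\lambda_{\min}(\Delta_\delta)>0$ for every $\delta>0$, $\lambda_{\min}(-P_\infty^-)>0$, and there are $\alpha,\beta>0$ such that $$\|\mathcal E_t(P_\infty)\|\le\alpha e^{-\beta t}\quad\text{for all }t\ge 0.\qquad(*)$$ (iv) For $\delta>0$ and positive semi-definite $Q$ set $$\chi_\delta:=\left[\lambda_{\min}(\Delta_\delta)\,\lambda_{\min}(-P_\infty^-)\right]^{-1},\qquad \chi(Q):=\|(P_\infty^-)^{-1}\|\left[\|P_\infty-P_\infty^-\|+\|Q-P_\infty\|\right].$$ Let $\alpha,\beta>0$ be any constants satisfying $(*)$. Then for all $t\ge\delta>0$,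 all positive semi-definite $Q_1,Q_2$ and all $x_1,x_2\in\mathbb R^r$, $$\|\widehat X_t(x_1,Q_1)-\widehat X_t(x_2,Q_2)\|\le\alpha\,\chi_\delta\,e^{-\beta t}\left(\chi_\delta\,\|\Delta_\infty\|\,\|x_1\|\,\|Q_1-Q_2\|+\|x_1-x_2\|\right),$$ and for all $t\ge 0$, all positive semi-definite $Q_1,Q_2$ and all $x_1,x_2\in\mathbb R^r$, $$\|\widehat X_t(x_1,Q_1)-\widehat X_t(x_2,Q_2)\|\le\alpha\,\chi(Q_2)\,e^{-\beta t}\left(\chi(Q_1)\,\|\Delta_\infty\|\,\|x_1\|\,\|Q_1-Q_2\|+\|x_1-x_2\|\right).$$ -/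

import Mathlib

open scoped Matrix.Norms.L2Operator

noncomputable section

namespace RiccatiMeanFlow

/-- Square real matrices of size `r`. In this file `‖M‖` is the spectral norm of a matrix, that is
its operator norm with respect to the Euclidean norm. -/
abbrev Mat (r : ℕ) : Type := Matrix (Fin r) (Fin r) ℝ

/-- The pair `(A, B)` is controllable: the `r × r²` block matrix `[B, A B, …, A ^ (r - 1) B]` has
rank `r`. The column with index `(k, j)` is the column `j` of the block `A ^ k B`. -/
def IsControllable {r : ℕ} (A B : Mat r) : Prop :=
  (Matrix.of fun (i : Fin r) (p : Fin r × Fin r) => (A ^ (p.1 : ℕ) * B) i p.2).rank = r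

/-- The Riccati drift `Ricc(P) = A P + P A' + R - P S P`. -/
def ricc {r : ℕ} (A R S P : Mat r) : Mat r :=
  A * P + P * A.transpose + R - P * S * P

/-- `P` is a positive definite fixed point of the Riccati equation. -/
def IsPosFixedPoint {r : ℕ} (A R S P : Mat r) : Prop :=
  P.PosDef ∧ ricc A R S P = 0

/-- `P` is a negative definite fixed point of the Riccati equation. -/
def IsNegFixedPoint {r : ℕ} (A R S P : Mat r) : Prop :=
  (-P).PosDef ∧ ricc A R S P = 0

/-- The positive definite fixed point `P_∞` (its existence and its uniqueness are part of the
theorem). -/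
def posFixedPoint {r : ℕ} (A R S : Mat r) : Mat r :=
  Classical.epsilon (IsPosFixedPoint A R S)

/-- The negative definite fixed point `P_∞⁻` (its existence and its uniqueness are part of the
theorem). -/
def negFixedPoint {r : ℕ} (A R S : Mat r) : Mat r :=
  Classical.epsilon (IsNegFixedPoint A R S)

/-- `φ` solves the matrix Riccati equation `∂ₜ φ = Ricc(φ)` on `[0, ∞)` with `φ(0) = Q`. -/
def IsRiccatiSolution {r : ℕ} (A R S Q : Mat r) (φ : ℝ → Mat r) : Prop :=
  φ 0 = Q ∧ ∀ t : ℝ, 0 ≤ t → HasDerivWithinAt φ (ricc A R S (φ t)) (Set.Ici 0) t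

/-- `E` solves the matrix equation `∂ₜ E = (A - φ S) E` on `[0, ∞)` with `E(0) = I`. -/
def IsTransition {r : ℕ} (A S : Mat r) (φ E : ℝ → Mat r) : Prop :=
  E 0 = 1 ∧ ∀ t : ℝ, 0 ≤ t → HasDerivWithinAt E ((A - φ t * S) * E t) (Set.Ici 0) t

/-- `X` solves the mean equation `∂ₜ X = (A - φ S) X` on `[0, ∞)` with `X(0) = x`. -/
def IsMeanSolution {r : ℕ} (A S : Mat r) (φ : ℝ → Mat r) (x : EuclideanSpace ℝ (Fin r))
    (X : ℝ → EuclideanSpace ℝ (Fin r)) : Prop :=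
  X 0 = x ∧
    ∀ t : ℝ, 0 ≤ t → HasDerivWithinAt X (Matrix.toEuclideanLin (A - φ t * S) (X t)) (Set.Ici 0) t

/-- The Riccati flow `t ↦ φₜ(Q)`. -/
def riccatiFlow {r : ℕ} (A R S Q : Mat r) : ℝ → Mat r :=
  Classical.epsilon (IsRiccatiSolution A R S Q)

/-- The exponential semigroup `t ↦ Eₜ(Q)` of the matrix flow `u ↦ A - φᵤ(Q) S`. -/
def transition {r : ℕ} (A R S Q : Mat r) : ℝ → Mat r :=
  Classical.epsilon (IsTransition A S (riccatiFlow A R S Q))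

/-- The mean flow `X̂ₜ(x, Q) = Eₜ(Q) x`. -/
def meanFlow {r : ℕ} (A R S : Mat r) (t : ℝ) (x : EuclideanSpace ℝ (Fin r)) (Q : Mat r) :
    EuclideanSpace ℝ (Fin r) :=
  Matrix.toEuclideanLin (transition A R S Q t) x

/-- The integrand `e^{s (A - P_∞ S)'} S e^{s (A - P_∞ S)}` of the Gramian matrices. -/
def gramianIntegrand {r : ℕ} (A R S : Mat r) (s : ℝ) : Mat r :=
  NormedSpace.exp (s • (A - posFixedPoint A R S * S).transpose) * S *
    NormedSpace.exp (s • (A - posFixedPoint A R S * S))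

/-- The Gramian `Δₜ`, the integral of the integrand over `[0, t]`. -/
def gramian {r : ℕ} (A R S : Mat r) (t : ℝ) : Mat r :=
  ∫ s in (0 : ℝ)..t, gramianIntegrand A R S s

/-- The Gramian `Δ_∞`, the integral of the integrand over `[0, ∞)`. -/
def gramianInf {r : ℕ} (A R S : Mat r) : Mat r :=
  ∫ s in Set.Ioi (0 : ℝ), gramianIntegrand A R S s

/-- The minimal eigenvalue of a symmetric matrix. -/
def lambdaMin {r : ℕ} (M : Mat r) : ℝ :=
  sInf (spectrum ℝ M)

/-- `χ(P) = ‖(P_∞⁻)⁻¹‖ (‖P_∞ - P_∞⁻‖ + ‖P - P_∞‖)`. -/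
def chi {r : ℕ} (A R S P : Mat r) : ℝ :=
  ‖(negFixedPoint A R S)⁻¹‖ *
    (‖posFixedPoint A R S - negFixedPoint A R S‖ + ‖P - posFixedPoint A R S‖)

/-- `χ_δ = (λ_min(Δ_δ) λ_min(-P_∞⁻))⁻¹`. -/
def chiDelta {r : ℕ} (A R S : Mat r) (δ : ℝ) : ℝ :=
  (lambdaMin (gramian A R S δ) * lambdaMin (-negFixedPoint A R S))⁻¹

end RiccatiMeanFlow

end

open RiccatiMeanFlow

namespace RiccatiMeanFlow

open Matrix Set Filter Topology

variable {r : ℕ}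

/-! ### Quadratic forms and norms -/

/-! Everything is read off from the two fixed points `P = P_∞` and `P' = P_∞⁻`. Put `B = A - P S`
and `G = (P - P')⁻¹`. Subtracting the two Riccati equations gives the Lyapunov equation `Bᵀ G + G B
= -S` (`lyapunov_of_fixedPoints`). Hence `Δₜ = G - e^{tBᵀ} G e^{tB}`. Observability makes `Δₜ`
positive definite for `t > 0`, so `x ↦ ⟨x, G x⟩` is a Lyapunov function, `e^{tB}` decays
exponentially and `Δ_∞ = G`.

For positive semi-definite `Q` the flows are explicit: with `Mₜ(Q) = I + (Q - P) Δₜ`, `Eₜ(Q) =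
e^{tB} Mₜ(Q)⁻¹` and `φₜ(Q) = P + Eₜ(Q) (Q - P) e^{tBᵀ}`. The Lipschitz bounds thus reduce to bounds
on `Mₜ(Q)⁻¹`. With `p = Δₜ w`, the inequality `Δₜ ≤ (P - P')⁻¹` yields `⟨p, w⟩ ≥ ⟨p, (P - P') p⟩`,
and so `⟨p, Mₜ(Q) w⟩ ≥ ⟨p, (Q - P') p⟩ ≥ λ_min(-P') ‖p‖²` (`lambdaMin_mul_norm_le`). Passing from
`p` back to `w` costs `χ_δ` or `χ(Q)`.

The positive fixed point is the limit of the decreasing Riccati solution that starts "at infinity",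
built as `Y X⁻¹` from the linear Hamiltonian system with `X₀ = 0`, `Y₀ = I`. The negative one comes
from the symmetry `(A, P) ↦ (-A, -P)`, and uniqueness from a Sylvester equation with stable
coefficients. -/

lemma mulVec_dotProduct (M : Mat r) (v w : Fin r → ℝ) : (M *ᵥ v) ⬝ᵥ w = v ⬝ᵥ (Mᵀ *ᵥ w) := by
  rw [dotProduct_mulVec, vecMul_transpose]

lemma dotProduct_self_eq_norm_sq (v : Fin r → ℝ) : v ⬝ᵥ v = ‖WithLp.toLp 2 v‖ ^ 2 := by
  rw [EuclideanSpace.real_norm_sq_eq]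
  simp [dotProduct, sq]

lemma dotProduct_le_norm_mul_norm (v w : Fin r → ℝ) :
    v ⬝ᵥ w ≤ ‖WithLp.toLp 2 v‖ * ‖WithLp.toLp 2 w‖ := by
  have h := real_inner_le_norm (WithLp.toLp 2 w) (WithLp.toLp 2 v)
  rw [EuclideanSpace.inner_toLp_toLp] at h
  simpa [mul_comm] using h

lemma norm_mulVec_le (M : Mat r) (v : Fin r → ℝ) :
    ‖WithLp.toLp 2 (M *ᵥ v)‖ ≤ ‖M‖ * ‖WithLp.toLp 2 v‖ :=
  l2_opNorm_mulVec M (WithLp.toLp 2 v)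

lemma dotProduct_le_norm_mul_sq (M : Mat r) (v : Fin r → ℝ) :
    v ⬝ᵥ (M *ᵥ v) ≤ ‖M‖ * ‖WithLp.toLp 2 v‖ ^ 2 :=
  (dotProduct_le_norm_mul_norm _ _).trans (by
    nlinarith [norm_mulVec_le M v, norm_nonneg (WithLp.toLp 2 v)])

lemma norm_le_of_mulVec_le {M : Mat r} {c : ℝ} (hc : 0 ≤ c)
    (h : ∀ v, ‖WithLp.toLp 2 (M *ᵥ v)‖ ≤ c * ‖WithLp.toLp 2 v‖) : ‖M‖ ≤ c := by
  rw [← l2_opNorm_toEuclideanCLM]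
  exact ContinuousLinearMap.opNorm_le_bound _ hc fun v => h v.ofLp

lemma norm_transpose_eq (M : Mat r) : ‖Mᵀ‖ = ‖M‖ := by
  rw [← conjTranspose_eq_transpose_of_trivial, l2_opNorm_conjTranspose]

lemma transpose_eq_of_posSemidef {M : Mat r} (h : M.PosSemidef) : Mᵀ = M := by
  simpa [IsHermitian] using h.isHermitian

lemma posSemidef_of_dotProduct {M : Mat r} (hs : Mᵀ = M) (h : ∀ v, 0 ≤ v ⬝ᵥ (M *ᵥ v)) :
    M.PosSemidef :=
  .of_dotProduct_mulVec_nonneg (by simpa [IsHermitian] using hs) (by simpa using h)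

lemma posDef_of_dotProduct {M : Mat r} (hs : Mᵀ = M) (h : ∀ v, v ≠ 0 → 0 < v ⬝ᵥ (M *ᵥ v)) :
    M.PosDef :=
  .of_dotProduct_mulVec_pos (by simpa [IsHermitian] using hs) (by simpa using h)

lemma dotProduct_nonneg {M : Mat r} (h : M.PosSemidef) (v : Fin r → ℝ) :
    0 ≤ v ⬝ᵥ (M *ᵥ v) := by
  simpa using h.dotProduct_mulVec_nonneg v

lemma dotProduct_pos {M : Mat r} (h : M.PosDef) {v : Fin r → ℝ} (hv : v ≠ 0) :
    0 < v ⬝ᵥ (M *ᵥ v) := by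
  simpa using h.dotProduct_mulVec_pos hv

lemma dotProduct_mulVec_comm {M : Mat r} (hs : Mᵀ = M) (v w : Fin r → ℝ) :
    v ⬝ᵥ (M *ᵥ w) = w ⬝ᵥ (M *ᵥ v) := by
  rw [dotProduct_comm, mulVec_dotProduct, hs]

/-- A symmetric matrix is determined by its quadratic form. -/
lemma apply_eq_of_symm {M : Mat r} (hs : Mᵀ = M) (i j : Fin r) :
    M i j = ((Pi.single i 1 + Pi.single j 1) ⬝ᵥ (M *ᵥ (Pi.single i 1 + Pi.single j 1))
      - Pi.single i 1 ⬝ᵥ (M *ᵥ Pi.single i 1) - Pi.single j 1 ⬝ᵥ (M *ᵥ Pi.single j 1)) / 2 := by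
  have h := dotProduct_mulVec_comm hs (Pi.single i 1) (Pi.single j 1)
  simp only [mulVec_add, dotProduct_add, add_dotProduct, ← h]
  simp
  ring

lemma mulVec_eq_zero_of_posSemidef {M : Mat r} (h : M.PosSemidef) {v : Fin r → ℝ}
    (hv : v ⬝ᵥ (M *ᵥ v) = 0) : M *ᵥ v = 0 :=
  (h.dotProduct_mulVec_zero_iff v).1 (by simpa using hv)

/-- Since `‖N v‖² = ⟨v, M v⟩`, controllability conditions stated with any symmetric root become
conditions on `R` and `S` themselves. -/
lemma mulVec_sqrt_eq_zero {M N : Mat r} (hN : N.IsSymm) (h : N * N = M) {v : Fin r → ℝ}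
    (hv : M *ᵥ v = 0) : N *ᵥ v = 0 := by
  rw [← dotProduct_self_eq_zero, mulVec_dotProduct, hN.eq, mulVec_mulVec, h, hv, dotProduct_zero]

/-! ### The minimal eigenvalue -/

/-- For `1 ≤ r` the spectrum is finite and nonempty, so the infimum is attained; the lower bound is
Parseval in an orthonormal eigenbasis. -/
lemma lambdaMin_spec (hr : 1 ≤ r) {M : Mat r} (hM : M.IsHermitian) :
    (∃ v : Fin r → ℝ, ‖WithLp.toLp 2 v‖ = 1 ∧ M *ᵥ v = lambdaMin M • v) ∧
      ∀ v : Fin r → ℝ, lambdaMin M * ‖WithLp.toLp 2 v‖ ^ 2 ≤ v ⬝ᵥ (M *ᵥ v) := by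
  have : Nonempty (Fin r) := ⟨⟨0, hr⟩⟩
  have hspec : spectrum ℝ M = range hM.eigenvalues := hM.spectrum_real_eq_range_eigenvalues
  have hfin : (range hM.eigenvalues).Finite := finite_range _
  have hmem : lambdaMin M ∈ range hM.eigenvalues := by
    rw [lambdaMin, hspec]
    exact (range_nonempty _).csInf_mem hfin
  have hle : ∀ i, lambdaMin M ≤ hM.eigenvalues i := fun i => by
    rw [lambdaMin, hspec]
    exact csInf_le hfin.bddBelow ⟨i, rfl⟩
  constructor
  · obtain ⟨i, hi⟩ := hmem
    refine ⟨(hM.eigenvectorBasis i).ofLp, hM.eigenvectorBasis.orthonormal.1 i, ?_⟩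
    rw [← hi]
    simpa using hM.mulVec_eigenvectorBasis i
  · intro v
    set x : EuclideanSpace ℝ (Fin r) := WithLp.toLp 2 v with hx
    set b := hM.eigenvectorBasis with hb
    have h1 : ‖x‖ ^ 2 = ∑ i, (inner ℝ (b i) x) ^ 2 := by
      rw [← b.sum_sq_norm_inner_right x]
      simp
    have h2 : v ⬝ᵥ (M *ᵥ v) = ∑ i, hM.eigenvalues i * (inner ℝ (b i) x) ^ 2 := by
      have h3 : v ⬝ᵥ (M *ᵥ v) = inner ℝ x (WithLp.toLp 2 (M *ᵥ v)) := by
        rw [hx, EuclideanSpace.inner_toLp_toLp, dotProduct_comm]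
        simp
      rw [h3, ← b.sum_inner_mul_inner]
      refine Finset.sum_congr rfl fun i _ => ?_
      have h4 : inner ℝ (b i) (WithLp.toLp 2 (M *ᵥ v)) = hM.eigenvalues i * inner ℝ (b i) x := by
        have h5 := hM.mulVec_eigenvectorBasis i
        have h6 : inner ℝ (b i) (WithLp.toLp 2 (M *ᵥ v)) = (b i).ofLp ⬝ᵥ (M *ᵥ v) := by
          rw [EuclideanSpace.inner_eq_star_dotProduct, dotProduct_comm]; simp
        have h7 : inner ℝ (b i) x = (b i).ofLp ⬝ᵥ v := by
          rw [EuclideanSpace.inner_eq_star_dotProduct, dotProduct_comm]; simp [hx]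
        rw [h6, h7, dotProduct_mulVec_comm (by simpa [IsHermitian] using hM), hb, h5,
          dotProduct_smul, dotProduct_comm]
        rfl
      rw [h4, real_inner_comm]
      ring
    rw [h1, h2, Finset.mul_sum]
    exact Finset.sum_le_sum fun i _ => mul_le_mul_of_nonneg_right (hle i) (sq_nonneg _)

lemma lambdaMin_pos (hr : 1 ≤ r) {M : Mat r} (hM : M.PosDef) : 0 < lambdaMin M := by
  obtain ⟨⟨v, hv, he⟩, -⟩ := lambdaMin_spec hr hM.isHermitian
  have h0 : v ≠ 0 := by rintro rfl; simp at hv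
  have h := dotProduct_pos hM h0
  rwa [he, dotProduct_smul, dotProduct_self_eq_norm_sq, hv, smul_eq_mul, one_pow, mul_one] at h

lemma inv_lambdaMin_le_norm_inv (hr : 1 ≤ r) {M : Mat r} (hM : M.PosDef) :
    (lambdaMin M)⁻¹ ≤ ‖M⁻¹‖ := by
  obtain ⟨⟨v, hv, he⟩, -⟩ := lambdaMin_spec hr hM.isHermitian
  have h0 := lambdaMin_pos hr hM
  have h1 : M⁻¹ *ᵥ v = (lambdaMin M)⁻¹ • v := by
    have h2 : M⁻¹ *ᵥ (M *ᵥ v) = v := by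
      rw [mulVec_mulVec, nonsing_inv_mul _ ((isUnit_iff_isUnit_det _).1 hM.isUnit), one_mulVec]
    rw [he, mulVec_smul] at h2
    rw [eq_inv_smul_iff₀ h0.ne', h2]
  have h3 := norm_mulVec_le M⁻¹ v
  rw [h1, WithLp.toLp_smul, norm_smul, hv, mul_one, mul_one, Real.norm_of_nonneg (by positivity)]
    at h3
  exact h3

/-- The spectral norm is monotone on positive semi-definite matrices. -/
lemma norm_le_norm_of_posSemidef {M N : Mat r} (hM : M.PosSemidef)
    (hMN : ∀ v, v ⬝ᵥ (M *ᵥ v) ≤ v ⬝ᵥ (N *ᵥ v)) : ‖M‖ ≤ ‖N‖ := by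
  have hN : ∀ v : Fin r → ℝ, v ⬝ᵥ (M *ᵥ v) ≤ ‖N‖ * ‖WithLp.toLp 2 v‖ ^ 2 := fun v =>
    (hMN v).trans (dotProduct_le_norm_mul_sq N v)
  refine norm_le_of_mulVec_le (norm_nonneg _) fun v => ?_
  set p := M *ᵥ v with hp
  set a := ‖WithLp.toLp 2 p‖ with ha
  set b := ‖WithLp.toLp 2 v‖ with hb
  by_cases hN0 : ‖N‖ = 0
  · have : p = 0 := mulVec_eq_zero_of_posSemidef hM
      (le_antisymm (by simpa [hN0] using hN v) (dotProduct_nonneg hM v))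
    rw [ha, this]
    simp only [WithLp.toLp_zero, norm_zero]
    positivity
  have hNp : 0 < ‖N‖ := lt_of_le_of_ne (norm_nonneg _) (Ne.symm hN0)
  -- This test vector avoids square roots: bounding the forms at `v` and at `p` by `‖N‖` leaves `‖N‖
  -- a² ≤ ‖N‖³ b²`.
  have h1 := dotProduct_nonneg hM (‖N‖ • v - p)
  have hsym := transpose_eq_of_posSemidef hM
  have h2 : v ⬝ᵥ (M *ᵥ p) = a ^ 2 := by
    rw [dotProduct_mulVec_comm hsym, ← hp, dotProduct_self_eq_norm_sq]
  have h3 : p ⬝ᵥ (M *ᵥ v) = a ^ 2 := by rw [← hp, dotProduct_self_eq_norm_sq]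
  simp only [mulVec_sub, mulVec_smul, dotProduct_sub, sub_dotProduct, dotProduct_smul,
    smul_dotProduct, smul_eq_mul, h2, h3] at h1
  have h4 := hN v
  have h5 := hN p
  rw [← ha] at h5
  rw [← hb] at h4
  have h6 : ‖N‖ * a ^ 2 ≤ ‖N‖ * (‖N‖ * b) ^ 2 := by
    nlinarith [mul_le_mul_of_nonneg_left h4 (sq_nonneg ‖N‖)]
  have h7 := le_of_mul_le_mul_left h6 hNp
  exact (sq_le_sq₀ (norm_nonneg _) (by positivity)).1 h7

/-! ### Calculus of matrix valued functions -/

/-- The linear functional `M ↦ v ⬝ᵥ M w`. -/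
def dotProductMulVecLin (v w : Fin r → ℝ) : Mat r →ₗ[ℝ] ℝ where
  toFun M := v ⬝ᵥ (M *ᵥ w)
  map_add' M N := by rw [add_mulVec, dotProduct_add]
  map_smul' c M := by rw [smul_mulVec, dotProduct_smul]; rfl

lemma continuous_dotProduct_mulVec (v w : Fin r → ℝ) :
    Continuous fun M : Mat r => v ⬝ᵥ (M *ᵥ w) :=
  (dotProductMulVecLin v w).toContinuousLinearMap.continuous

lemma hasDerivAt_dotProduct {F : ℝ → Mat r} {F' : Mat r} {t : ℝ}
    (h : HasDerivAt F F' t) (v w : Fin r → ℝ) :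
    HasDerivAt (fun u => v ⬝ᵥ (F u *ᵥ w)) (v ⬝ᵥ (F' *ᵥ w)) t :=
  ((dotProductMulVecLin v w).toContinuousLinearMap.hasFDerivAt).comp_hasDerivAt t h

lemma hasDerivAt_mulVec {F : ℝ → Mat r} {F' : Mat r} {t : ℝ}
    (h : HasDerivAt F F' t) (w : Fin r → ℝ) :
    HasDerivAt (fun u => F u *ᵥ w) (F' *ᵥ w) t := by
  let L : Mat r →ₗ[ℝ] (Fin r → ℝ) :=
    { toFun := fun M => M *ᵥ w
      map_add' := fun M N => add_mulVec _ _ _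
      map_smul' := fun c M => smul_mulVec _ _ _ }
  exact (L.toContinuousLinearMap.hasFDerivAt).comp_hasDerivAt t h

lemma hasDerivAt_const_mulVec {y : ℝ → Fin r → ℝ} {y' : Fin r → ℝ} {t : ℝ} (M : Mat r)
    (h : HasDerivAt y y' t) : HasDerivAt (fun u => M *ᵥ y u) (M *ᵥ y') t :=
  (M.mulVecLin.toContinuousLinearMap.hasFDerivAt).comp_hasDerivAt t h

lemma hasDerivWithinAt_toEuclideanLin {F : ℝ → Mat r} {F' : Mat r} {s : Set ℝ} {t : ℝ}
    (h : HasDerivWithinAt F F' s t) (x : EuclideanSpace ℝ (Fin r)) :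
    HasDerivWithinAt (fun u => toEuclideanLin (F u) x) (toEuclideanLin F' x) s t := by
  let L : Mat r →ₗ[ℝ] EuclideanSpace ℝ (Fin r) :=
    { toFun := fun M => toEuclideanLin M x
      map_add' := fun M N => by rw [map_add]; rfl
      map_smul' := fun c M => by rw [map_smul]; rfl }
  exact (L.toContinuousLinearMap.hasFDerivAt).comp_hasDerivWithinAt t h

lemma hasDerivAt_transpose {F : ℝ → Mat r} {F' : Mat r} {t : ℝ} (h : HasDerivAt F F' t) :
    HasDerivAt (fun u => (F u)ᵀ) F'ᵀ t := by
  let L : Mat r →ₗ[ℝ] Mat r :=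
    { toFun := fun M => Mᵀ
      map_add' := fun M N => transpose_add _ _
      map_smul' := fun c M => transpose_smul _ _ }
  exact (L.toContinuousLinearMap.hasFDerivAt).comp_hasDerivAt t h

lemma hasDerivAt_matrix_inv {F : ℝ → Mat r} {F' : Mat r} {t : ℝ} (h : HasDerivAt F F' t)
    (hu : IsUnit (F t)) : HasDerivAt (fun u => (F u)⁻¹) (-((F t)⁻¹ * F' * (F t)⁻¹)) t := by
  obtain ⟨u, hu⟩ := hu
  have h1 : HasFDerivAt (Ring.inverse : Mat r → Mat r) _ (F t) :=
    hu ▸ hasFDerivAt_ringInverse (𝕜 := ℝ) u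
  have h2 := h1.comp_hasDerivAt t h
  have h3 : (F t)⁻¹ = ((u⁻¹ : (Mat r)ˣ) : Mat r) := by
    rw [nonsing_inv_eq_ringInverse, ← hu, Ring.inverse_unit]
  rw [h3]
  simp only [nonsing_inv_eq_ringInverse]
  exact h2

lemma hasDerivAt_exp_smul (B : Mat r) (t : ℝ) :
    HasDerivAt (fun s : ℝ => NormedSpace.exp (s • B)) (B * NormedSpace.exp (t • B)) t :=
  hasDerivAt_exp_smul_const' B t

/-- Uniqueness for linear differential inequalities on the half line. -/
lemma eq_zero_of_norm_deriv_le {E : Type*} [NormedAddCommGroup E] [NormedSpace ℝ E]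
    {f f' : ℝ → E} {k : ℝ → ℝ} (hk : ContinuousOn k (Ici 0))
    (hf : ∀ t, 0 ≤ t → HasDerivWithinAt f (f' t) (Ici 0) t) (h0 : f 0 = 0)
    (hb : ∀ t, 0 ≤ t → ‖f' t‖ ≤ k t * ‖f t‖) (t : ℝ) (ht : 0 ≤ t) : f t = 0 := by
  obtain ⟨K, hK⟩ := isCompact_Icc.bddAbove_image (hk.mono (Icc_subset_Ici_self : Icc 0 t ⊆ _))
  refine eq_zero_of_abs_deriv_le_mul_abs_self_of_eq_zero_right (f := f) (f' := f') (K := K)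
    (a := 0) (b := t) (fun s hs => ((hf s hs.1).continuousWithinAt).mono Icc_subset_Ici_self)
    (fun s hs => (hf s hs.1).mono (Ici_subset_Ici.2 hs.1)) h0 (fun s hs => ?_) t ⟨ht, le_rfl⟩
  exact (hb s hs.1).trans (mul_le_mul_of_nonneg_right
    (hK ⟨s, ⟨hs.1, hs.2.le⟩, rfl⟩) (norm_nonneg _))

/-! ### Controllability and observability -/

/-- The transposed block matrix has full column rank, hence trivial kernel, and `w` lies in it; only
the powers below `r` matter. -/
lemma eq_zero_of_controllable {A B : Mat r} (h : IsControllable A B) {w : Fin r → ℝ}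
    (hw : ∀ k : ℕ, Bᵀ *ᵥ ((Aᵀ) ^ k *ᵥ w) = 0) : w = 0 := by
  set C : Matrix (Fin r) (Fin r × Fin r) ℝ :=
    Matrix.of fun (i : Fin r) (p : Fin r × Fin r) => (A ^ (p.1 : ℕ) * B) i p.2 with hC
  have hrank : Cᵀ.rank = r := by rw [rank_transpose]; exact h
  have hker : LinearMap.ker Cᵀ.mulVecLin = ⊥ := by
    have h1 := Cᵀ.mulVecLin.finrank_range_add_finrank_ker
    rw [← Matrix.rank, hrank] at h1
    simp only [Module.finrank_fintype_fun_eq_card, Fintype.card_fin] at h1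
    exact Submodule.finrank_eq_zero.1 (by omega)
  have h2 : Cᵀ.mulVecLin w = 0 := by
    ext ⟨k, j⟩
    have h3 := congrFun (hw k) j
    rw [mulVec_mulVec, ← transpose_pow, ← transpose_mul] at h3
    exact h3
  exact (LinearMap.ker_eq_bot'.1 hker) w h2

/-- The pair `(A, S)` is observable: only the zero vector has `S (A ^ k w) = 0` for every `k`. -/
def IsObservable (A S : Mat r) : Prop :=
  ∀ w : Fin r → ℝ, (∀ k : ℕ, S *ᵥ (A ^ k *ᵥ w) = 0) → w = 0

lemma IsControllable.isObservable {A S Sh : Mat r} (hSh : Sh.IsSymm) (hSS : Sh * Sh = S)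
    (hAS : IsControllable Aᵀ Sh) : IsObservable A S := fun w hw =>
  eq_zero_of_controllable hAS fun k => by
    rw [transpose_transpose, hSh.eq]
    exact mulVec_sqrt_eq_zero hSh hSS (hw k)

lemma IsObservable.neg {A S : Mat r} (h : IsObservable A S) : IsObservable (-A) S := fun w hw =>
  h w fun k => by
    rcases k.even_or_odd with hk | hk
    · simpa [hk.neg_pow] using hw k
    · simpa [hk.neg_pow, neg_mulVec, mulVec_neg] using hw k

/-- An unobserved trajectory of an observable system vanishes. -/
lemma IsObservable.eq_zero {A S : Mat r} (h : IsObservable A S) {a b : ℝ} {y : ℝ → Fin r → ℝ}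
    (hy : ∀ t ∈ Ioo a b, HasDerivAt y (A *ᵥ y t) t) (hS : ∀ t ∈ Ioo a b, S *ᵥ y t = 0) :
    ∀ t ∈ Ioo a b, y t = 0 := by
  have key : ∀ k : ℕ, ∀ t ∈ Ioo a b, S *ᵥ (A ^ k *ᵥ y t) = 0 := by
    intro k
    induction k with
    | zero => simpa using hS
    | succ k ih =>
      intro t ht
      -- Differentiating `S A^k y = 0` along the flow produces the next power of `A`.
      have h1 := hasDerivAt_const_mulVec S (hasDerivAt_const_mulVec (A ^ k) (hy t ht))
      have h2 : HasDerivAt (fun u => S *ᵥ (A ^ k *ᵥ y u)) 0 t :=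
        (hasDerivAt_const t (0 : Fin r → ℝ)).congr_of_eventuallyEq
          (by filter_upwards [isOpen_Ioo.mem_nhds ht] with u hu using ih u hu)
      have h3 := h1.unique h2
      rw [mulVec_mulVec (y t) (A ^ k), ← pow_succ] at h3
      exact h3
  exact fun t ht => h _ fun k => key k t ht

/-! ### Existence of a positive definite fixed point -/

lemma eq_of_hasDerivAt_zero {E : Type*} [NormedAddCommGroup E] [NormedSpace ℝ E] {f : ℝ → E}
    (h : ∀ t, HasDerivAt f 0 t) (s t : ℝ) : f s = f t :=
  is_const_of_deriv_eq_zero (fun u => (h u).differentiableAt) (fun u => (h u).deriv) s t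

lemma monotone_of_hasDerivAt {g g' : ℝ → ℝ} (h : ∀ t, HasDerivAt g (g' t) t)
    (h0 : ∀ t, 0 ≤ g' t) : Monotone g :=
  monotone_of_deriv_nonneg (fun u => (h u).differentiableAt) fun u => (h u).deriv ▸ h0 u

lemma deriv_eq_zero_of_monotone {g g' : ℝ → ℝ} (h : ∀ t, HasDerivAt g (g' t) t)
    (h0 : ∀ t, 0 ≤ g' t) {a b : ℝ} (hab : g a = g b) : ∀ t ∈ Ioo a b, g' t = 0 := by
  intro t ht
  have hm := monotone_of_hasDerivAt h h0
  refine (h t).unique ((hasDerivAt_const t (g a)).congr_of_eventuallyEq ?_)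
  filter_upwards [isOpen_Ioo.mem_nhds ht] with u hu
  exact le_antisymm (hab ▸ hm hu.2.le) (hm hu.1.le)

/-- `(X, Y)` solves the Hamiltonian system of the Riccati equation, started at `(0, I)`. -/
def IsHamiltonianFlow (A R S : Mat r) (X Y : ℝ → Mat r) : Prop :=
  X 0 = 0 ∧ Y 0 = 1 ∧ ∀ t, HasDerivAt X (-(Aᵀ * X t) + S * Y t) t ∧
    HasDerivAt Y (R * X t + A * Y t) t

lemma exists_linear_flow {E : Type*} [NormedAddCommGroup E] [NormedSpace ℝ E]
    [FiniteDimensional ℝ E] (L : E →ₗ[ℝ] E) (z₀ : E) :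
    ∃ z : ℝ → E, z 0 = z₀ ∧ ∀ t, HasDerivAt z (L (z t)) t := by
  have : CompleteSpace E := FiniteDimensional.complete ℝ E
  refine ⟨fun t => NormedSpace.exp (t • L.toContinuousLinearMap) z₀, by simp, fun t => ?_⟩
  simpa using (hasDerivAt_exp_smul_const' L.toContinuousLinearMap t).clm_apply
    (hasDerivAt_const t z₀)

lemma exists_isHamiltonianFlow (A R S : Mat r) : ∃ X Y, IsHamiltonianFlow A R S X Y := by
  let L : (Mat r × Mat r) →ₗ[ℝ] (Mat r × Mat r) :=
    { toFun := fun z => (-(Aᵀ * z.1) + S * z.2, R * z.1 + A * z.2)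
      map_add' := fun z w => by ext1 <;> simp only [Prod.fst_add, Prod.snd_add] <;> noncomm_ring
      map_smul' := fun c z => by
        ext1 <;> simp [smul_add, smul_neg] }
  obtain ⟨z, hz0, hz⟩ := exists_linear_flow L (0, 1)
  refine ⟨fun t => (z t).1, fun t => (z t).2, by simp [hz0], by simp [hz0], fun t => ⟨?_, ?_⟩⟩
  · exact (hz t).fst
  · exact (hz t).snd

namespace IsHamiltonianFlow

variable {A R S : Mat r} {X Y : ℝ → Mat r}

/-- The symplectic form `Xᵀ Y - Yᵀ X` is conserved and vanishes at time `0`. This makes `Y X⁻¹`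
symmetric. -/
lemma transpose_mul_comm (h : IsHamiltonianFlow A R S X Y) (hR : R.PosSemidef)
    (hS : S.PosSemidef) (t : ℝ) : (X t)ᵀ * Y t = (Y t)ᵀ * X t := by
  obtain ⟨h0, -, h⟩ := h
  have hd : ∀ t, HasDerivAt (fun u => (X u)ᵀ * Y u - (Y u)ᵀ * X u) 0 t := fun t => by
    have h1 := ((hasDerivAt_transpose (h t).1).mul (h t).2).sub
      ((hasDerivAt_transpose (h t).2).mul (h t).1)
    refine h1.congr_deriv ?_
    simp only [transpose_add, transpose_neg, transpose_mul, transpose_transpose,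
      transpose_eq_of_posSemidef hR, transpose_eq_of_posSemidef hS]
    noncomm_ring
  have h2 := eq_of_hasDerivAt_zero hd t 0
  simp only [h0, transpose_zero, zero_mul, mul_zero, sub_zero] at h2
  exact sub_eq_zero.1 h2

/-- The quadratic Hamiltonian is conserved, with value `-S` at `X = 0`, `Y = I`. For `φ = Y X⁻¹` it
equals `Xᵀ Ricc(φ) X`, which makes `φ` decreasing. -/
lemma energy_eq (h : IsHamiltonianFlow A R S X Y) (hR : R.PosSemidef) (hS : S.PosSemidef)
    (t : ℝ) : (X t)ᵀ * (R * X t + A * Y t) - (Y t)ᵀ * (-(Aᵀ * X t) + S * Y t) = -S := by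
  obtain ⟨h0, h0', h⟩ := h
  have hd : ∀ t, HasDerivAt (fun u => (X u)ᵀ * (R * X u + A * Y u)
      - (Y u)ᵀ * (-(Aᵀ * X u) + S * Y u)) 0 t := fun t => by
    have h1 := ((hasDerivAt_transpose (h t).1).mul
        (((h t).1.const_mul R).add ((h t).2.const_mul A))).sub
      ((hasDerivAt_transpose (h t).2).mul
        (((h t).1.const_mul Aᵀ).neg.add ((h t).2.const_mul S)))
    refine h1.congr_deriv ?_
    simp only [transpose_add, transpose_neg, transpose_mul, transpose_transpose,
      transpose_eq_of_posSemidef hR, transpose_eq_of_posSemidef hS, Pi.add_apply, Pi.neg_apply]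
    noncomm_ring
  have h2 := eq_of_hasDerivAt_zero hd t 0
  simpa [h0, h0'] using h2

lemma hasDerivAt_pairing (h : IsHamiltonianFlow A R S X Y) (hS : S.PosSemidef)
    (v : Fin r → ℝ) (t : ℝ) : HasDerivAt (fun u => (X u *ᵥ v) ⬝ᵥ (Y u *ᵥ v))
      ((Y t *ᵥ v) ⬝ᵥ (S *ᵥ (Y t *ᵥ v)) + (X t *ᵥ v) ⬝ᵥ (R *ᵥ (X t *ᵥ v))) t := by
  obtain ⟨-, -, h⟩ := h
  have h1 := hasDerivAt_dotProduct ((hasDerivAt_transpose (h t).1).mul (h t).2) v v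
  have h2 : (fun u => (X u *ᵥ v) ⬝ᵥ (Y u *ᵥ v)) =
      fun u => v ⬝ᵥ (((fun s => (X s)ᵀ) * Y) u *ᵥ v) := by
    funext u
    rw [mulVec_dotProduct, mulVec_mulVec]; rfl
  rw [h2]
  refine h1.congr_deriv ?_
  rw [mulVec_dotProduct, mulVec_dotProduct, ← dotProduct_add]
  simp only [mulVec_mulVec, ← add_mulVec]
  congr 2
  simp only [transpose_add, transpose_neg, transpose_mul, transpose_transpose,
      transpose_eq_of_posSemidef hS]
  noncomm_ring

lemma pairing_nonneg (h : IsHamiltonianFlow A R S X Y) (hR : R.PosSemidef) (hS : S.PosSemidef)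
    (v : Fin r → ℝ) {t : ℝ} (ht : 0 ≤ t) : 0 ≤ (X t *ᵥ v) ⬝ᵥ (Y t *ᵥ v) := by
  have h1 := monotone_of_hasDerivAt (h.hasDerivAt_pairing hS v)
    (fun u => add_nonneg (dotProduct_nonneg hS _) (dotProduct_nonneg hR _)) ht
  simpa [h.1] using h1

/-- If `X t v = 0`, the monotone pairing `⟨X v, Y v⟩` vanishes at both ends of `[0, t]`, so its
derivative vanishes inside: `S Y v = 0` and `R X v = 0`. The system then decouples, and
observability kills `X v` and `Y v`. -/
lemma isUnit (h : IsHamiltonianFlow A R S X Y) (hR : R.PosSemidef) (hS : S.PosSemidef)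
    (hAR : IsObservable Aᵀ R) (hAS : IsObservable A S) {t : ℝ} (ht : 0 < t) : IsUnit (X t) := by
  rw [← mulVec_injective_iff_isUnit]
  refine (injective_iff_map_eq_zero (X t).mulVecLin).2 fun v hv => ?_
  rw [mulVecLin_apply] at hv
  have h1 := deriv_eq_zero_of_monotone (h.hasDerivAt_pairing hS v)
    (fun u => add_nonneg (dotProduct_nonneg hS _) (dotProduct_nonneg hR _))
    (a := 0) (b := t) (by simp [h.1, hv])
  have hSY : ∀ s ∈ Ioo 0 t, S *ᵥ (Y s *ᵥ v) = 0 := fun s hs =>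
    mulVec_eq_zero_of_posSemidef hS (by
      have := h1 s hs
      have := dotProduct_nonneg hS (Y s *ᵥ v)
      have := dotProduct_nonneg hR (X s *ᵥ v)
      linarith)
  have hRX : ∀ s ∈ Ioo 0 t, R *ᵥ (X s *ᵥ v) = 0 := fun s hs =>
    mulVec_eq_zero_of_posSemidef hR (by
      have := h1 s hs
      have := dotProduct_nonneg hS (Y s *ᵥ v)
      have := dotProduct_nonneg hR (X s *ᵥ v)
      linarith)
  have hX : ∀ s ∈ Ioo 0 t, X s *ᵥ v = 0 := by
    refine hAR.neg.eq_zero (fun s hs => ?_) hRX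
    refine (hasDerivAt_mulVec (h.2.2 s).1 v).congr_deriv ?_
    rw [add_mulVec, ← mulVec_mulVec v S, hSY s hs, add_zero, neg_mulVec, neg_mulVec, mulVec_mulVec]
  have hY : ∀ s ∈ Ioo 0 t, Y s *ᵥ v = 0 := by
    refine hAS.eq_zero (fun s hs => ?_) hSY
    refine (hasDerivAt_mulVec (h.2.2 s).2 v).congr_deriv ?_
    rw [add_mulVec, ← mulVec_mulVec v R, hRX s hs, zero_add, mulVec_mulVec]
  -- The limit at `0⁺` transfers `Y s v = 0` to `Y 0 v = v`.
  have hc := (hasDerivAt_mulVec (h.2.2 0).2 v).continuousAt.tendsto.mono_left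
    (nhdsWithin_le_nhds (s := Ioi 0))
  have hc' : Tendsto (fun s => Y s *ᵥ v) (𝓝[>] 0) (𝓝 0) :=
    tendsto_const_nhds.congr' (by
      filter_upwards [Ioo_mem_nhdsGT ht] with s hs using (hY s hs).symm)
  simpa [h.2.1] using tendsto_nhds_unique hc hc'

end IsHamiltonianFlow

/-! ### Limits of decreasing Riccati solutions -/

lemma ricc_transpose {A R S P : Mat r} (hR : R.PosSemidef) (hS : S.PosSemidef) (hP : Pᵀ = P) :
    (ricc A R S P)ᵀ = ricc A R S P := by
  simp only [ricc, transpose_add, transpose_sub, transpose_mul, transpose_transpose, hP,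
    transpose_eq_of_posSemidef hR, transpose_eq_of_posSemidef hS]
  noncomm_ring

lemma eq_zero_of_dotProduct {M : Mat r} (hs : Mᵀ = M) (h : ∀ v, v ⬝ᵥ (M *ᵥ v) = 0) : M = 0 := by
  ext i j
  simp [apply_eq_of_symm hs i j, -mulVec_single, h]

lemma continuous_ricc (A R S : Mat r) : Continuous (ricc A R S) := by
  unfold ricc
  fun_prop

/-- A matrix valued function whose quadratic forms converge is convergent. -/
lemma exists_tendsto_of_dotProduct {φ : ℝ → Mat r} (hs : ∀ t, 0 < t → (φ t)ᵀ = φ t)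
    (h : ∀ v, ∃ l, Tendsto (fun t => v ⬝ᵥ (φ t *ᵥ v)) atTop (𝓝 l)) :
    ∃ P, Tendsto φ atTop (𝓝 P) := by
  choose l hl using h
  refine ⟨Matrix.of fun i j => (l (Pi.single i 1 + Pi.single j 1) - l (Pi.single i 1)
    - l (Pi.single j 1)) / 2, ?_⟩
  refine tendsto_pi_nhds.2 fun i => tendsto_pi_nhds.2 fun j => ?_
  refine ((((hl _).sub (hl _)).sub (hl _)).div_const 2).congr' ?_
  filter_upwards [eventually_gt_atTop 0] with t ht
  exact (apply_eq_of_symm (hs t ht) i j).symm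

/-- A nonnegative function which decreases on the positive half line converges. -/
lemma exists_tendsto_of_deriv_nonpos {g g' : ℝ → ℝ} (h : ∀ t, 0 < t → HasDerivAt g (g' t) t)
    (hd : ∀ t, 0 < t → g' t ≤ 0) (h0 : ∀ t, 0 < t → 0 ≤ g t) :
    ∃ l, Tendsto g atTop (𝓝 l) := by
  have ha : AntitoneOn g (Ioi 0) := by
    refine antitoneOn_of_deriv_nonpos (convex_Ioi 0)
      (fun t ht => (h t ht).continuousAt.continuousWithinAt) (fun t ht => ?_) fun t ht => ?_
    · rw [interior_Ioi] at ht
      exact (h t ht).differentiableAt.differentiableWithinAt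
    · rw [interior_Ioi] at ht
      exact (h t ht).deriv ▸ hd t ht
  have hp : ∀ t : ℝ, 0 < max t 1 := fun t => lt_max_of_lt_right one_pos
  have hm : Antitone fun t => g (max t 1) := fun s t hst =>
    ha (hp s) (hp t) (max_le_max_right 1 hst)
  refine ⟨_, (tendsto_atTop_ciInf hm ⟨0, ?_⟩).congr' ?_⟩
  · rintro _ ⟨t, rfl⟩
    exact h0 _ (hp t)
  · filter_upwards [eventually_ge_atTop 1] with t ht
    rw [max_eq_left ht]

/-- A decreasing positive semi-definite solution of the Riccati equation converges to a positive
semi-definite fixed point. -/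
lemma exists_posSemidef_fixedPoint {A R S : Mat r} (hR : R.PosSemidef) (hS : S.PosSemidef)
    {φ : ℝ → Mat r} (hφ : ∀ t, 0 < t → (φ t).PosSemidef)
    (hd : ∀ t, 0 < t → HasDerivAt φ (ricc A R S (φ t)) t)
    (hneg : ∀ t, 0 < t → ∀ v, v ⬝ᵥ (ricc A R S (φ t) *ᵥ v) ≤ 0) :
    ∃ P : Mat r, P.PosSemidef ∧ ricc A R S P = 0 := by
  have hq : ∀ v, ∀ t, 0 < t → HasDerivAt (fun t => v ⬝ᵥ (φ t *ᵥ v))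
      (v ⬝ᵥ (ricc A R S (φ t) *ᵥ v)) t := fun v t ht => hasDerivAt_dotProduct (hd t ht) v v
  obtain ⟨P, hP⟩ := exists_tendsto_of_dotProduct
    (fun t ht => transpose_eq_of_posSemidef (hφ t ht)) fun v =>
      exists_tendsto_of_deriv_nonpos (hq v) (fun t ht => hneg t ht v)
        fun t ht => dotProduct_nonneg (hφ t ht) v
  have hlim : ∀ v w, Tendsto (fun t => v ⬝ᵥ (φ t *ᵥ w)) atTop (𝓝 (v ⬝ᵥ (P *ᵥ w))) :=
    fun v w => ((continuous_dotProduct_mulVec v w).tendsto P).comp hP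
  have hsymm : Pᵀ = P := by
    ext i j
    have h1 := (hlim (Pi.single j 1) (Pi.single i 1)).congr' (f₂ := fun t =>
      Pi.single i 1 ⬝ᵥ (φ t *ᵥ Pi.single j 1)) (by
        filter_upwards [eventually_gt_atTop 0] with t ht
        exact dotProduct_mulVec_comm (transpose_eq_of_posSemidef (hφ t ht)) _ _)
    simpa using tendsto_nhds_unique h1 (hlim _ _)
  refine ⟨P, posSemidef_of_dotProduct hsymm fun v => ge_of_tendsto (hlim v v) ?_,
    eq_zero_of_dotProduct (ricc_transpose hR hS hsymm) fun v => ?_⟩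
  · filter_upwards [eventually_gt_atTop 0] with t ht using dotProduct_nonneg (hφ t ht) v
  -- The mean value theorem on `[n + 1, n + 2]`, which stays inside `t > 0`, gives times `c n → ∞`
  -- at which the drift is a difference of two values with the same limit.
  · have hmv : ∀ n : ℕ, ∃ c : ℝ, (n : ℝ) + 1 < c ∧ v ⬝ᵥ (ricc A R S (φ c) *ᵥ v) =
        v ⬝ᵥ (φ ((n : ℝ) + 2) *ᵥ v) - v ⬝ᵥ (φ ((n : ℝ) + 1) *ᵥ v) := fun n => by
      have hn : (0 : ℝ) ≤ n := n.cast_nonneg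
      obtain ⟨c, hc, he⟩ := exists_hasDerivAt_eq_slope (fun t => v ⬝ᵥ (φ t *ᵥ v))
        (fun t => v ⬝ᵥ (ricc A R S (φ t) *ᵥ v)) (a := n + 1) (b := n + 2) (by linarith)
        (fun t ht => (hq v t (by linarith [ht.1])).continuousAt.continuousWithinAt)
        (fun t ht => hq v t (by linarith [ht.1]))
      refine ⟨c, hc.1, he.trans ?_⟩
      rw [add_sub_add_left_eq_sub]
      norm_num
    choose c hc he using hmv
    have hct : Tendsto c atTop atTop := tendsto_atTop_mono (fun n => by linarith [hc n])
      tendsto_natCast_atTop_atTop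
    have h1 : Tendsto (fun n => v ⬝ᵥ (ricc A R S (φ (c n)) *ᵥ v)) atTop
        (𝓝 (v ⬝ᵥ (ricc A R S P *ᵥ v))) :=
      (((continuous_dotProduct_mulVec v v).comp (continuous_ricc A R S)).tendsto P).comp
        (hP.comp hct)
    have h2 := ((hlim v v).comp (tendsto_atTop_add_const_right atTop (2 : ℝ)
      (tendsto_natCast_atTop_atTop (R := ℝ)))).sub ((hlim v v).comp
        (tendsto_atTop_add_const_right atTop (1 : ℝ) (tendsto_natCast_atTop_atTop (R := ℝ))))
    rw [sub_self] at h2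
    exact tendsto_nhds_unique (h1.congr he) h2

/-- Evaluating the fixed point equation on the kernel of `P` shows that this kernel is contained in
that of `R` and is invariant under `Aᵀ`; observability of `(Aᵀ, R)` makes it trivial. -/
lemma posDef_of_fixedPoint {A R S P : Mat r} (hR : R.PosSemidef) (hAR : IsObservable Aᵀ R)
    (hP : P.PosSemidef) (h : ricc A R S P = 0) : P.PosDef := by
  have hsymm := transpose_eq_of_posSemidef hP
  have step : ∀ w, P *ᵥ w = 0 → R *ᵥ w = 0 ∧ P *ᵥ (Aᵀ *ᵥ w) = 0 := fun w hw => by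
    have h1 : ricc A R S P *ᵥ w = P *ᵥ (Aᵀ *ᵥ w) + R *ᵥ w := by
      simp only [ricc, add_mulVec, sub_mulVec, ← mulVec_mulVec, hw, mulVec_zero]
      simp
    rw [h, zero_mulVec] at h1
    have h2 : w ⬝ᵥ (P *ᵥ (Aᵀ *ᵥ w)) = 0 := by
      rw [dotProduct_mulVec_comm hsymm, hw, dotProduct_zero]
    have h3 : w ⬝ᵥ (R *ᵥ w) = 0 := by
      have := congrArg (fun x => w ⬝ᵥ x) h1
      rw [dotProduct_zero, dotProduct_add, h2, zero_add] at this
      exact this.symm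
    have h4 := mulVec_eq_zero_of_posSemidef hR h3
    exact ⟨h4, by simpa [h4] using h1.symm⟩
  have hker : ∀ w, P *ᵥ w = 0 → w = 0 := fun w hw => by
    have h1 : ∀ k : ℕ, P *ᵥ (Aᵀ ^ k *ᵥ w) = 0 := fun k => by
      induction k with
      | zero => simpa using hw
      | succ k ih =>
        rw [pow_succ', ← mulVec_mulVec]
        exact (step _ ih).2
    exact hAR w fun k => (step _ (h1 k)).1
  exact posDef_of_dotProduct hsymm fun v hv =>
    lt_of_le_of_ne (dotProduct_nonneg hP v) fun h0 =>
      hv (hker v (mulVec_eq_zero_of_posSemidef hP h0.symm))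

theorem exists_isPosFixedPoint {A R S : Mat r} (hR : R.PosSemidef) (hS : S.PosSemidef)
    (hAR : IsObservable Aᵀ R) (hAS : IsObservable A S) : ∃ P, IsPosFixedPoint A R S P := by
  obtain ⟨X, Y, h⟩ := exists_isHamiltonianFlow A R S
  have hu : ∀ t, 0 < t → IsUnit (X t).det := fun t ht =>
    (isUnit_iff_isUnit_det _).1 (h.isUnit hR hS hAR hAS ht)
  set φ : ℝ → Mat r := fun t => Y t * (X t)⁻¹ with hφ
  have hφX : ∀ t, 0 < t → φ t * X t = Y t := fun t ht => by
    rw [hφ, mul_assoc, nonsing_inv_mul _ (hu t ht), mul_one]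
  have hsurj : ∀ t, 0 < t → ∀ v, ∃ u, v = X t *ᵥ u := fun t ht v =>
    ⟨(X t)⁻¹ *ᵥ v, by rw [mulVec_mulVec, mul_nonsing_inv _ (hu t ht), one_mulVec]⟩
  have hsymm : ∀ t, 0 < t → (φ t)ᵀ = φ t := fun t ht => by
    rw [hφ]
    simp only
    rw [transpose_mul, transpose_nonsing_inv]
    have hu' : IsUnit (X t)ᵀ.det := by rw [det_transpose]; exact hu t ht
    calc (X t)ᵀ⁻¹ * (Y t)ᵀ = (X t)ᵀ⁻¹ * ((Y t)ᵀ * X t) * (X t)⁻¹ := by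
          rw [mul_assoc, mul_assoc, mul_nonsing_inv _ (hu t ht), mul_one]
      _ = (X t)ᵀ⁻¹ * (X t)ᵀ * (Y t * (X t)⁻¹) := by
          rw [← h.transpose_mul_comm hR hS]; noncomm_ring
      _ = _ := by rw [nonsing_inv_mul _ hu', one_mul]
  have hpos : ∀ t, 0 < t → (φ t).PosSemidef := fun t ht =>
    posSemidef_of_dotProduct (hsymm t ht) fun v => by
      obtain ⟨u, rfl⟩ := hsurj t ht v
      rw [mulVec_mulVec u (φ t), hφX t ht]
      exact h.pairing_nonneg hR hS u ht.le
  have hderiv : ∀ t, 0 < t → HasDerivAt φ (ricc A R S (φ t)) t := fun t ht => by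
    have h1 := (h.2.2 t).2.mul (hasDerivAt_matrix_inv (h.2.2 t).1
      (h.isUnit hR hS hAR hAS ht))
    refine h1.congr_deriv ?_
    have hx : X t * (X t)⁻¹ = 1 := mul_nonsing_inv _ (hu t ht)
    have e1 : (R * X t + A * Y t) * (X t)⁻¹ = R * (X t * (X t)⁻¹) + A * (Y t * (X t)⁻¹) := by
      noncomm_ring
    have e2 : Y t * -((X t)⁻¹ * (-(Aᵀ * X t) + S * Y t) * (X t)⁻¹) =
        (Y t * (X t)⁻¹) * Aᵀ * (X t * (X t)⁻¹) - (Y t * (X t)⁻¹) * S * (Y t * (X t)⁻¹) := by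
      noncomm_ring
    rw [e1, e2, hx, ricc]
    simp only [hφ]
    noncomm_ring
  have hneg : ∀ t, 0 < t → ∀ v, v ⬝ᵥ (ricc A R S (φ t) *ᵥ v) ≤ 0 := fun t ht v => by
    obtain ⟨u, rfl⟩ := hsurj t ht v
    have hXφ : (X t)ᵀ * φ t = (Y t)ᵀ := by
      rw [← hφX t ht, transpose_mul, hsymm t ht]
    have h1 : (X t)ᵀ * ricc A R S (φ t) * X t = -S := by
      rw [← h.energy_eq hR hS t, ← hXφ, ← hφX t ht, ricc]
      noncomm_ring
    rw [mulVec_dotProduct, mulVec_mulVec, mulVec_mulVec, h1, neg_mulVec, dotProduct_neg]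
    exact neg_nonpos.2 (dotProduct_nonneg hS u)
  obtain ⟨P, hP, h0⟩ := exists_posSemidef_fixedPoint hR hS hpos hderiv hneg
  exact ⟨P, posDef_of_fixedPoint hR hAR hP h0, h0⟩

theorem exists_isNegFixedPoint {A R S : Mat r} (hR : R.PosSemidef) (hS : S.PosSemidef)
    (hAR : IsObservable Aᵀ R) (hAS : IsObservable A S) : ∃ P, IsNegFixedPoint A R S P := by
  have hAR' : IsObservable (-A)ᵀ R := by rw [transpose_neg]; exact hAR.neg
  obtain ⟨P, hP, h⟩ := exists_isPosFixedPoint hR hS hAR' hAS.neg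
  refine ⟨-P, by rwa [neg_neg], ?_⟩
  rw [← h, ricc, ricc, transpose_neg]
  noncomm_ring

/-! ### Lyapunov equation and exponential stability -/

/-- On a vector with `S (A - P S)^k w = 0` for all `k`, the feedback term never acts, so the powers
of `A - P S` and of `A` agree. -/
lemma IsObservable.sub_mul {A S : Mat r} (h : IsObservable A S) (P : Mat r) :
    IsObservable (A - P * S) S := fun w hw => by
  have key : ∀ k : ℕ, (A - P * S) ^ k *ᵥ w = A ^ k *ᵥ w := fun k => by
    induction k with
    | zero => simp
    | succ k ih =>
      rw [pow_succ', ← mulVec_mulVec, sub_mulVec, ← mulVec_mulVec _ P, hw k, mulVec_zero, sub_zero,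
        ih, mulVec_mulVec, ← pow_succ']
  exact h w fun k => by rw [← key k]; exact hw k

lemma isUnit_det_of_posDef {M : Mat r} (h : M.PosDef) : IsUnit M.det :=
  (isUnit_iff_isUnit_det _).1 h.isUnit

/-- The inverse of the gap between two fixed points solves the Lyapunov equation of the closed
loop matrix `A - P S`. -/
lemma lyapunov_of_fixedPoints {A R S P P' : Mat r} (hP : Pᵀ = P)
    (hS : Sᵀ = S) (h : ricc A R S P = 0) (h' : ricc A R S P' = 0) (hD : (P - P').PosDef) :
    (A - P * S)ᵀ * (P - P')⁻¹ + (P - P')⁻¹ * (A - P * S) = -S := by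
  set D := P - P' with hDdef
  have hu := isUnit_det_of_posDef hD
  -- This is the difference of the two Riccati equations; conjugation by `D⁻¹` turns it into the
  -- Lyapunov equation.
  have h1 : D * (A - P * S)ᵀ + (A - P * S) * D = D * (-S) * D := by
    rw [transpose_sub, transpose_mul, hP, hS]
    have h2 : ricc A R S P - ricc A R S P' = 0 := by rw [h, h', sub_zero]
    rw [← sub_eq_zero, ← h2, hDdef, ricc, ricc]
    noncomm_ring
  calc (A - P * S)ᵀ * D⁻¹ + D⁻¹ * (A - P * S)
      = (D⁻¹ * D) * (A - P * S)ᵀ * D⁻¹ + D⁻¹ * (A - P * S) * (D * D⁻¹) := by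
        rw [nonsing_inv_mul _ hu, mul_nonsing_inv _ hu, one_mul, mul_one]
    _ = D⁻¹ * (D * (A - P * S)ᵀ + (A - P * S) * D) * D⁻¹ := by noncomm_ring
    _ = (D⁻¹ * D) * (-S) * (D * D⁻¹) := by rw [h1]; noncomm_ring
    _ = -S := by rw [nonsing_inv_mul _ hu, mul_nonsing_inv _ hu, one_mul, mul_one]

/-- The Gramian of `B` at time `t`, expressed by a solution `G` of the Lyapunov equation. -/
noncomputable def lyapunovGramian (B G : Mat r) (t : ℝ) : Mat r :=
  G - (NormedSpace.exp (t • B))ᵀ * G * NormedSpace.exp (t • B)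

section Lyapunov

variable {B G S : Mat r}

lemma hasDerivAt_lyapunovGramian (hL : Bᵀ * G + G * B = -S) (t : ℝ) :
    HasDerivAt (lyapunovGramian B G)
      ((NormedSpace.exp (t • B))ᵀ * S * NormedSpace.exp (t • B)) t := by
  have h := (((hasDerivAt_transpose (hasDerivAt_exp_smul B t)).mul_const G).mul
    (hasDerivAt_exp_smul B t)).const_sub G
  refine h.congr_deriv ?_
  rw [← neg_neg S, ← hL, transpose_mul]
  noncomm_ring

lemma dotProduct_conj (U M : Mat r) (v : Fin r → ℝ) :
    v ⬝ᵥ ((Uᵀ * M * U) *ᵥ v) = (U *ᵥ v) ⬝ᵥ (M *ᵥ (U *ᵥ v)) := by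
  rw [mulVec_dotProduct, mulVec_mulVec, mulVec_mulVec, mul_assoc]

lemma lyapunovGramian_zero : lyapunovGramian B G 0 = 0 := by
  simp [lyapunovGramian]

lemma dotProduct_lyapunovGramian (t : ℝ) (v : Fin r → ℝ) :
    v ⬝ᵥ (lyapunovGramian B G t *ᵥ v) = v ⬝ᵥ (G *ᵥ v)
      - (NormedSpace.exp (t • B) *ᵥ v) ⬝ᵥ (G *ᵥ (NormedSpace.exp (t • B) *ᵥ v)) := by
  rw [lyapunovGramian, sub_mulVec, dotProduct_sub, dotProduct_conj]

lemma hasDerivAt_dotProduct_lyapunovGramian (hL : Bᵀ * G + G * B = -S) (v : Fin r → ℝ) (t : ℝ) :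
    HasDerivAt (fun t => v ⬝ᵥ (lyapunovGramian B G t *ᵥ v))
      ((NormedSpace.exp (t • B) *ᵥ v) ⬝ᵥ (S *ᵥ (NormedSpace.exp (t • B) *ᵥ v))) t := by
  rw [← dotProduct_conj]
  exact hasDerivAt_dotProduct (hasDerivAt_lyapunovGramian hL t) v v

lemma monotone_lyapunovGramian (hS : S.PosSemidef) (hL : Bᵀ * G + G * B = -S) (v : Fin r → ℝ) :
    Monotone fun t => v ⬝ᵥ (lyapunovGramian B G t *ᵥ v) :=
  monotone_of_hasDerivAt (hasDerivAt_dotProduct_lyapunovGramian hL v)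
    fun _ => dotProduct_nonneg hS _

lemma lyapunovGramian_transpose (hG : Gᵀ = G) (t : ℝ) :
    (lyapunovGramian B G t)ᵀ = lyapunovGramian B G t := by
  simp only [lyapunovGramian, transpose_sub, transpose_mul, transpose_transpose, hG, mul_assoc]

lemma lyapunovGramian_posSemidef (hS : S.PosSemidef) (hG : G.PosDef)
    (hL : Bᵀ * G + G * B = -S) {t : ℝ} (ht : 0 ≤ t) : (lyapunovGramian B G t).PosSemidef :=
  posSemidef_of_dotProduct
    (lyapunovGramian_transpose (transpose_eq_of_posSemidef hG.posSemidef) t) fun v => by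
      simpa [lyapunovGramian_zero] using monotone_lyapunovGramian hS hL v ht

lemma dotProduct_lyapunovGramian_le (hG : G.PosDef) (t : ℝ) (v : Fin r → ℝ) :
    v ⬝ᵥ (lyapunovGramian B G t *ᵥ v) ≤ v ⬝ᵥ (G *ᵥ v) := by
  rw [dotProduct_lyapunovGramian]
  exact sub_le_self _ (dotProduct_nonneg hG.posSemidef _)

lemma exp_mulVec_eq_zero {t : ℝ} {v : Fin r → ℝ} (h : NormedSpace.exp (t • B) *ᵥ v = 0) :
    v = 0 := by
  have hu := (isUnit_iff_isUnit_det _).1 (isUnit_exp (t • B))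
  rw [← one_mulVec v, ← nonsing_inv_mul _ hu, ← mulVec_mulVec, h, mulVec_zero]

/-- A null vector of the form makes it constant on `[0, t]` by monotonicity, hence `S e^{sB} v = 0`
there, which observability forbids unless `v = 0`. -/
lemma lyapunovGramian_posDef (hS : S.PosSemidef) (hG : G.PosDef)
    (hL : Bᵀ * G + G * B = -S) (hobs : IsObservable B S) {t : ℝ} (ht : 0 < t) :
    (lyapunovGramian B G t).PosDef := by
  have hpos := lyapunovGramian_posSemidef hS hG hL ht.le
  refine posDef_of_dotProduct (transpose_eq_of_posSemidef hpos) fun v hv =>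
    lt_of_le_of_ne (dotProduct_nonneg hpos v) fun h0 => hv ?_
  have h1 := deriv_eq_zero_of_monotone (hasDerivAt_dotProduct_lyapunovGramian hL v)
    (fun _ => dotProduct_nonneg hS _) (a := 0) (b := t)
    (by rw [← h0, lyapunovGramian_zero]; simp)
  have h2 := hobs.eq_zero (y := fun s => NormedSpace.exp (s • B) *ᵥ v) (a := 0) (b := t)
    (fun s _ => by
      rw [mulVec_mulVec]
      exact hasDerivAt_mulVec (hasDerivAt_exp_smul B s) v)
    (fun s hs => mulVec_eq_zero_of_posSemidef hS (h1 s hs))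
  exact exp_mulVec_eq_zero (h2 (t / 2) ⟨by linarith, by linarith⟩)

lemma lambdaMin_le_norm (hr : 1 ≤ r) {M : Mat r} (hM : M.IsHermitian) : lambdaMin M ≤ ‖M‖ := by
  obtain ⟨⟨v, hv, -⟩, h⟩ := lambdaMin_spec hr hM
  simpa [hv] using (h v).trans (dotProduct_le_norm_mul_sq M v)

/-- Over one unit of time `V(x) = ⟨x, G x⟩` loses `⟨x, Δ₁ x⟩ ≥ ε V(x)`, so it shrinks by at least `1
- ε ≤ e^{-ε}`. Iterate over integers and use that `V` does not increase in between. -/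
lemma exists_exp_decay (hr : 1 ≤ r) (hS : S.PosSemidef) (hG : G.PosDef)
    (hL : Bᵀ * G + G * B = -S) (hobs : IsObservable B S) :
    ∃ α β : ℝ, 0 < α ∧ 0 < β ∧ ∀ t : ℝ, 0 ≤ t →
      ‖NormedSpace.exp (t • B)‖ ≤ α * Real.exp (-β * t) := by
  have hΔ := lyapunovGramian_posDef hS hG hL hobs one_pos
  have hl := lambdaMin_pos hr hΔ
  have hg := lambdaMin_pos hr hG
  have hGn : 0 < ‖G‖ := hg.trans_le (lambdaMin_le_norm hr hG.isHermitian)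
  set ε := lambdaMin (lyapunovGramian B G 1) / ‖G‖ with hε
  have hεp : 0 < ε := div_pos hl hGn
  set V : (Fin r → ℝ) → ℝ := fun x => x ⬝ᵥ (G *ᵥ x) with hV
  have hstep : ∀ x, V (NormedSpace.exp B *ᵥ x) ≤ Real.exp (-ε) * V x := fun x => by
    have h1 := dotProduct_lyapunovGramian (B := B) (G := G) 1 x
    rw [one_smul] at h1
    have h2 := (lambdaMin_spec hr hΔ.isHermitian).2 x
    have h3 : ε * V x ≤ lambdaMin (lyapunovGramian B G 1) * ‖WithLp.toLp 2 x‖ ^ 2 := by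
      refine (mul_le_mul_of_nonneg_left (dotProduct_le_norm_mul_sq G x) hεp.le).trans_eq ?_
      rw [hε]
      field_simp
    have h4 := mul_le_mul_of_nonneg_right (Real.add_one_le_exp (-ε))
      (dotProduct_nonneg hG.posSemidef x)
    simp only [hV] at h3 ⊢
    linarith
  have hiter : ∀ n : ℕ, ∀ x, V (NormedSpace.exp ((n : ℝ) • B) *ᵥ x) ≤
      Real.exp (-ε * n) * V x := fun n x => by
    induction n with
    | zero => simp
    | succ n ih =>
      have h1 : NormedSpace.exp (((n + 1 : ℕ) : ℝ) • B) =
          NormedSpace.exp B * NormedSpace.exp ((n : ℝ) • B) := by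
        rw [← exp_add_of_commute _ _ ((Commute.refl B).smul_right _)]
        congr 1
        push_cast
        rw [add_smul, one_smul, add_comm]
      rw [h1, ← mulVec_mulVec]
      refine (hstep _).trans ((mul_le_mul_of_nonneg_left ih (Real.exp_pos _).le).trans_eq ?_)
      rw [← mul_assoc, ← Real.exp_add]
      congr 2
      push_cast
      ring
  have hcont : ∀ t : ℝ, 0 ≤ t → ∀ x, V (NormedSpace.exp (t • B) *ᵥ x) ≤
      Real.exp ε * Real.exp (-ε * t) * V x := fun t ht x => by
    have h1 := monotone_lyapunovGramian hS hL x (Nat.floor_le ht)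
    simp only [dotProduct_lyapunovGramian] at h1
    have h2 := hiter ⌊t⌋₊ x
    -- The factor `e^ε` pays for rounding `t` down.
    have h3 : Real.exp (-ε * ⌊t⌋₊) ≤ Real.exp ε * Real.exp (-ε * t) := by
      rw [← Real.exp_add, Real.exp_le_exp]
      nlinarith [Nat.lt_floor_add_one t]
    have h4 := mul_le_mul_of_nonneg_right h3 (dotProduct_nonneg hG.posSemidef x)
    simp only [hV] at h2 ⊢
    linarith
  -- Comparing `V` with `‖·‖²` costs `‖G‖ / λ_min(G)`; the square root also halves the rate to `ε /
  -- 2`.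
  set α := Real.sqrt (Real.exp ε * ‖G‖ / lambdaMin G) with hα
  have hα2 : α ^ 2 = Real.exp ε * ‖G‖ / lambdaMin G := Real.sq_sqrt (by positivity)
  refine ⟨α, ε / 2, by positivity, by positivity, fun t ht => ?_⟩
  refine norm_le_of_mulVec_le (by positivity) fun x => ?_
  rw [← sq_le_sq₀ (norm_nonneg _) (by positivity), mul_pow, mul_pow, hα2, ← Real.exp_nat_mul]
  have h1 := (lambdaMin_spec hr hG.isHermitian).2 (NormedSpace.exp (t • B) *ᵥ x)
  have h2 := h1.trans ((hcont t ht x).trans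
    (mul_le_mul_of_nonneg_left (dotProduct_le_norm_mul_sq G x) (by positivity)))
  rw [mul_comm, ← le_div_iff₀ hg] at h2
  refine h2.trans_eq ?_
  have h3 : ((2 : ℕ) : ℝ) * (-(ε / 2) * t) = -ε * t := by push_cast; ring
  rw [h3]
  ring

lemma continuous_exp_smul (B : Mat r) : Continuous fun s : ℝ => NormedSpace.exp (s • B) :=
  continuous_iff_continuousAt.2 fun s => (hasDerivAt_exp_smul B s).continuousAt

lemma continuous_conj_exp (B S : Mat r) : Continuous fun s : ℝ =>
    (NormedSpace.exp (s • B))ᵀ * S * NormedSpace.exp (s • B) := by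
  have h : Continuous fun s : ℝ => (NormedSpace.exp (s • B))ᵀ :=
    continuous_iff_continuousAt.2 fun s =>
      (hasDerivAt_transpose (hasDerivAt_exp_smul B s)).continuousAt
  exact (h.mul continuous_const).mul (continuous_exp_smul B)

lemma norm_conj_le (U M : Mat r) : ‖Uᵀ * M * U‖ ≤ ‖M‖ * ‖U‖ ^ 2 := by
  refine (norm_mul_le _ _).trans
    ((mul_le_mul_of_nonneg_right (norm_mul_le _ _) (norm_nonneg _)).trans_eq ?_)
  rw [norm_transpose_eq]
  ring

lemma norm_conj_exp_le {α β : ℝ} (h : ∀ t : ℝ, 0 ≤ t →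
      ‖NormedSpace.exp (t • B)‖ ≤ α * Real.exp (-β * t)) (M : Mat r) {t : ℝ} (ht : 0 ≤ t) :
    ‖(NormedSpace.exp (t • B))ᵀ * M * NormedSpace.exp (t • B)‖ ≤
      ‖M‖ * α ^ 2 * Real.exp (-(2 * β) * t) := by
  refine (norm_conj_le _ _).trans ((mul_le_mul_of_nonneg_left
    (pow_le_pow_left₀ (norm_nonneg _) (h t ht) 2) (norm_nonneg _)).trans_eq ?_)
  rw [mul_pow, ← Real.exp_nat_mul, mul_assoc]
  congr 3
  push_cast
  ring

lemma intervalIntegral_conj_exp (hL : Bᵀ * G + G * B = -S) (t : ℝ) :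
    ∫ s in (0 : ℝ)..t, (NormedSpace.exp (s • B))ᵀ * S * NormedSpace.exp (s • B) =
      lyapunovGramian B G t := by
  rw [intervalIntegral.integral_eq_sub_of_hasDerivAt
    (fun s _ => hasDerivAt_lyapunovGramian hL s)
    ((continuous_conj_exp B S).intervalIntegrable 0 t), lyapunovGramian_zero, sub_zero]

lemma integrableOn_conj_exp {α β : ℝ} (hβ : 0 < β) (h : ∀ t : ℝ, 0 ≤ t →
      ‖NormedSpace.exp (t • B)‖ ≤ α * Real.exp (-β * t)) :
    MeasureTheory.IntegrableOn (fun s : ℝ =>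
      (NormedSpace.exp (s • B))ᵀ * S * NormedSpace.exp (s • B)) (Ioi 0) := by
  have h1 := (exp_neg_integrableOn_Ioi 0 (mul_pos two_pos hβ)).const_mul (‖S‖ * α ^ 2)
  refine MeasureTheory.Integrable.mono' h1
    (continuous_conj_exp B S).aestronglyMeasurable ?_
  filter_upwards [MeasureTheory.ae_restrict_mem measurableSet_Ioi] with s hs
  exact norm_conj_exp_le h S (le_of_lt hs)

lemma tendsto_conj_exp {α β : ℝ} (hβ : 0 < β) (h : ∀ t : ℝ, 0 ≤ t →
      ‖NormedSpace.exp (t • B)‖ ≤ α * Real.exp (-β * t)) (M : Mat r) :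
    Tendsto (fun t : ℝ => (NormedSpace.exp (t • B))ᵀ * M * NormedSpace.exp (t • B)) atTop
      (𝓝 0) := by
  have h1 : Tendsto (fun t : ℝ => ‖M‖ * α ^ 2 * Real.exp (-(2 * β) * t)) atTop (𝓝 0) := by
    rw [← mul_zero (‖M‖ * α ^ 2)]
    exact (Real.tendsto_exp_atBot.comp
      (tendsto_id.const_mul_atTop_of_neg (by linarith))).const_mul _
  refine squeeze_zero_norm' ?_ h1
  filter_upwards [eventually_ge_atTop 0] with t ht using norm_conj_exp_le h M ht

lemma integral_Ioi_conj_exp (hL : Bᵀ * G + G * B = -S) {α β : ℝ} (hβ : 0 < β)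
    (h : ∀ t : ℝ, 0 ≤ t → ‖NormedSpace.exp (t • B)‖ ≤ α * Real.exp (-β * t)) :
    ∫ s in Ioi (0 : ℝ), (NormedSpace.exp (s • B))ᵀ * S * NormedSpace.exp (s • B) = G := by
  have h1 := MeasureTheory.integral_Ioi_of_hasDerivAt_of_tendsto' (a := 0)
    (fun s _ => hasDerivAt_lyapunovGramian hL s) (integrableOn_conj_exp hβ h)
    (m := G) (by
      have h2 := (tendsto_conj_exp hβ h G).const_sub G
      rw [sub_zero] at h2
      exact h2)
  rw [h1, lyapunovGramian_zero, sub_zero]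

end Lyapunov

/-- A Sylvester equation with two exponentially stable coefficients has only the zero solution. -/
lemma eq_zero_of_sylvester {B₁ B₂ Z : Mat r} (hZ : B₁ * Z + Z * B₂ᵀ = 0) {α₁ β₁ α₂ β₂ : ℝ}
    (hβ₁ : 0 < β₁) (hβ₂ : 0 < β₂)
    (h₁ : ∀ t : ℝ, 0 ≤ t → ‖NormedSpace.exp (t • B₁)‖ ≤ α₁ * Real.exp (-β₁ * t))
    (h₂ : ∀ t : ℝ, 0 ≤ t → ‖NormedSpace.exp (t • B₂)‖ ≤ α₂ * Real.exp (-β₂ * t)) : Z = 0 := by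
  -- The product `e^{tB₁} Z e^{tB₂ᵀ}` is constant by the Sylvester equation, equals `Z` at `0`, and
  -- tends to `0`.
  have hd : ∀ t, HasDerivAt (fun t : ℝ => NormedSpace.exp (t • B₁) * Z *
      (NormedSpace.exp (t • B₂))ᵀ) 0 t := fun t => by
    have h := ((hasDerivAt_exp_smul_const B₁ t).mul_const Z).mul
      (hasDerivAt_transpose (hasDerivAt_exp_smul B₂ t))
    refine h.congr_deriv ?_
    rw [transpose_mul]
    have e : NormedSpace.exp (t • B₁) * B₁ * Z * (NormedSpace.exp (t • B₂))ᵀ +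
        NormedSpace.exp (t • B₁) * Z * ((NormedSpace.exp (t • B₂))ᵀ * B₂ᵀ) =
        NormedSpace.exp (t • B₁) * (B₁ * Z + Z * B₂ᵀ) * (NormedSpace.exp (t • B₂))ᵀ := by
      have hc : (NormedSpace.exp (t • B₂))ᵀ * B₂ᵀ = B₂ᵀ * (NormedSpace.exp (t • B₂))ᵀ := by
        rw [← transpose_mul, ← transpose_mul]
        congr 1
        exact (((Commute.refl B₂).smul_right t).exp_right).eq
      rw [hc]
      noncomm_ring
    rw [e, hZ, mul_zero, zero_mul]
  have hconst : ∀ t : ℝ, NormedSpace.exp (t • B₁) * Z * (NormedSpace.exp (t • B₂))ᵀ = Z :=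
    fun t => by simpa using eq_of_hasDerivAt_zero hd t 0
  have hdec : ∀ {B : Mat r} {α β : ℝ}, 0 < β → (∀ t : ℝ, 0 ≤ t → ‖NormedSpace.exp (t • B)‖ ≤
      α * Real.exp (-β * t)) → Tendsto (fun t : ℝ => ‖NormedSpace.exp (t • B)‖) atTop (𝓝 0) := by
    intro B α β hβ h
    have h1 : Tendsto (fun t : ℝ => α * Real.exp (-β * t)) atTop (𝓝 0) := by
      rw [← mul_zero α]
      exact (Real.tendsto_exp_atBot.comp
        (tendsto_id.const_mul_atTop_of_neg (by linarith))).const_mul _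
    refine squeeze_zero' (.of_forall fun t => norm_nonneg _) ?_ h1
    filter_upwards [eventually_ge_atTop 0] with t ht using h t ht
  have hlim := ((hdec hβ₁ h₁).mul_const ‖Z‖).mul (hdec hβ₂ h₂)
  rw [zero_mul, zero_mul] at hlim
  refine norm_le_zero_iff.1 (ge_of_tendsto hlim (.of_forall fun t => ?_))
  calc ‖Z‖ = ‖NormedSpace.exp (t • B₁) * Z * (NormedSpace.exp (t • B₂))ᵀ‖ := by rw [hconst t]
    _ ≤ _ := by
      refine (norm_mul_le _ _).trans ?_
      rw [norm_transpose_eq]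
      exact mul_le_mul_of_nonneg_right (norm_mul_le _ _) (norm_nonneg _)

/-! ### Closed-loop stability and uniqueness of the fixed points -/

section FixedPoints

variable {A R S P P' : Mat r}

lemma IsPosFixedPoint.sub_posDef (hP : IsPosFixedPoint A R S P)
    (hP' : IsNegFixedPoint A R S P') : (P - P').PosDef := by
  rw [sub_eq_add_neg]
  exact hP.1.add hP'.1

lemma IsPosFixedPoint.lyapunov (hS : S.PosSemidef) (hP : IsPosFixedPoint A R S P)
    (hP' : IsNegFixedPoint A R S P') :
    (A - P * S)ᵀ * (P - P')⁻¹ + (P - P')⁻¹ * (A - P * S) = -S :=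
  lyapunov_of_fixedPoints (transpose_eq_of_posSemidef hP.1.posSemidef)
    (transpose_eq_of_posSemidef hS) hP.2 hP'.2 (hP.sub_posDef hP')

lemma IsPosFixedPoint.exists_exp_decay (hr : 1 ≤ r) (hS : S.PosSemidef)
    (hAS : IsObservable A S) (hP : IsPosFixedPoint A R S P) (hP' : IsNegFixedPoint A R S P') :
    ∃ α β : ℝ, 0 < α ∧ 0 < β ∧ ∀ t : ℝ, 0 ≤ t →
      ‖NormedSpace.exp (t • (A - P * S))‖ ≤ α * Real.exp (-β * t) :=
  RiccatiMeanFlow.exists_exp_decay hr hS (hP.sub_posDef hP').inv (hP.lyapunov hS hP')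
    (hAS.sub_mul P)

/-- With `Z = P₁ - P₂`, subtracting the equations gives `(A - P₁ S) Z + Z (A - P₂ S)ᵀ = 0`, where
both closed loops are stable. -/
theorem IsPosFixedPoint.eq (hr : 1 ≤ r) (hR : R.PosSemidef) (hS : S.PosSemidef)
    (hAR : IsObservable Aᵀ R) (hAS : IsObservable A S) {P₁ P₂ : Mat r}
    (h₁ : IsPosFixedPoint A R S P₁) (h₂ : IsPosFixedPoint A R S P₂) : P₁ = P₂ := by
  obtain ⟨P', hP'⟩ := exists_isNegFixedPoint hR hS hAR hAS
  obtain ⟨α₁, β₁, -, hβ₁, hd₁⟩ := h₁.exists_exp_decay hr hS hAS hP'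
  obtain ⟨α₂, β₂, -, hβ₂, hd₂⟩ := h₂.exists_exp_decay hr hS hAS hP'
  refine sub_eq_zero.1 (eq_zero_of_sylvester ?_ hβ₁ hβ₂ hd₁ hd₂)
  have h : ricc A R S P₁ - ricc A R S P₂ = 0 := by rw [h₁.2, h₂.2, sub_zero]
  rw [← h, ricc, ricc, transpose_sub, transpose_mul, transpose_eq_of_posSemidef hS,
    transpose_eq_of_posSemidef h₂.1.posSemidef]
  noncomm_ring

theorem IsNegFixedPoint.eq (hr : 1 ≤ r) (hR : R.PosSemidef) (hS : S.PosSemidef)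
    (hAR : IsObservable Aᵀ R) (hAS : IsObservable A S) {P₁ P₂ : Mat r}
    (h₁ : IsNegFixedPoint A R S P₁) (h₂ : IsNegFixedPoint A R S P₂) : P₁ = P₂ := by
  have hneg : ∀ {P}, IsNegFixedPoint A R S P → IsPosFixedPoint (-A) R S (-P) := fun {P} h => by
    refine ⟨h.1, ?_⟩
    rw [← h.2, ricc, ricc, transpose_neg]
    noncomm_ring
  have hAR' : IsObservable (-A)ᵀ R := by rw [transpose_neg]; exact hAR.neg
  exact neg_injective ((hneg h₁).eq hr hR hS hAR' hAS.neg (hneg h₂))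

end FixedPoints

/-! ### The factor relating a general flow to the stationary one -/

/-- The matrix `I + (Q - P) Δ`. -/
def flowFactor (P Δ Q : Mat r) : Mat r := 1 + (Q - P) * Δ

lemma flowFactor_mulVec (P Δ Q : Mat r) (w : Fin r → ℝ) :
    flowFactor P Δ Q *ᵥ w = w + (Q - P) *ᵥ (Δ *ᵥ w) := by
  rw [flowFactor, add_mulVec, one_mulVec, mulVec_mulVec]

section Factor

variable {P P' Δ Q : Mat r}

/-- `Δ ≤ D⁻¹` implies `Δ D Δ ≤ Δ`: test `Δ ≥ 0` at `w - D Δ w`. No inverse of `Δ` is needed, so `Δ₀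
= 0` is allowed. -/
lemma dotProduct_gram_le {D : Mat r} (hD : D.PosDef) (hΔ : Δ.PosSemidef)
    (hle : ∀ v, v ⬝ᵥ (Δ *ᵥ v) ≤ v ⬝ᵥ (D⁻¹ *ᵥ v)) (w : Fin r → ℝ) :
    (Δ *ᵥ w) ⬝ᵥ (D *ᵥ (Δ *ᵥ w)) ≤ (Δ *ᵥ w) ⬝ᵥ w := by
  set p := Δ *ᵥ w with hp
  set q := D *ᵥ p with hq
  have hΔs := transpose_eq_of_posSemidef hΔ
  have h1 := dotProduct_nonneg hΔ (w - q)
  have h2 : D⁻¹ *ᵥ q = p := by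
    rw [hq, mulVec_mulVec, nonsing_inv_mul _ (isUnit_det_of_posDef hD), one_mulVec]
  have h3 := hle q
  rw [h2] at h3
  have h4 : w ⬝ᵥ (Δ *ᵥ q) = p ⬝ᵥ q := by
    rw [dotProduct_mulVec_comm hΔs, ← hp, dotProduct_comm]
  simp only [mulVec_sub, dotProduct_sub, sub_dotProduct, h4, ← hp] at h1
  rw [dotProduct_comm q p] at h1 h3
  rw [dotProduct_comm w p] at h1
  linarith

/-- Pairing `w + (Q - P) p` with `p = Δ w` leaves at least `⟨p, (Q - P') p⟩`, since `⟨p, w⟩ ≥ ⟨p, (P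
- P') p⟩`; then Cauchy–Schwarz. -/
lemma lambdaMin_mul_norm_le (hr : 1 ≤ r) (hP' : (-P').PosDef) (hD : (P - P').PosDef)
    (hQ : Q.PosSemidef) (hΔ : Δ.PosSemidef)
    (hle : ∀ v, v ⬝ᵥ (Δ *ᵥ v) ≤ v ⬝ᵥ ((P - P')⁻¹ *ᵥ v)) (w : Fin r → ℝ) :
    lambdaMin (-P') * ‖WithLp.toLp 2 (Δ *ᵥ w)‖ ≤
      ‖WithLp.toLp 2 (flowFactor P Δ Q *ᵥ w)‖ := by
  set p := Δ *ᵥ w with hp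
  have h1 := dotProduct_gram_le hD hΔ hle w
  rw [← hp] at h1
  have h2 := (lambdaMin_spec hr hP'.isHermitian).2 p
  have h3 := dotProduct_le_norm_mul_norm p (flowFactor P Δ Q *ᵥ w)
  have h4 := dotProduct_nonneg hQ p
  rw [flowFactor_mulVec, ← hp] at h3 ⊢
  simp only [dotProduct_add, sub_mulVec, dotProduct_sub, neg_mulVec, dotProduct_neg]
    at h1 h2 h3 ⊢
  rcases (norm_nonneg (WithLp.toLp 2 p)).eq_or_lt with h0 | h0
  · rw [← h0, mul_zero]
    exact norm_nonneg _
  · refine le_of_mul_le_mul_left ?_ h0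
    nlinarith

lemma norm_le_lambdaMin_mul (hr : 1 ≤ r) (hP' : (-P').PosDef) (hD : (P - P').PosDef)
    (hQ : Q.PosSemidef) (hΔ : Δ.PosSemidef)
    (hle : ∀ v, v ⬝ᵥ (Δ *ᵥ v) ≤ v ⬝ᵥ ((P - P')⁻¹ *ᵥ v)) {Δ₀ : Mat r} (hΔ₀ : Δ₀.PosDef)
    (hle₀ : ∀ v, v ⬝ᵥ (Δ₀ *ᵥ v) ≤ v ⬝ᵥ (Δ *ᵥ v)) (w : Fin r → ℝ) :
    ‖WithLp.toLp 2 w‖ ≤ (lambdaMin Δ₀ * lambdaMin (-P'))⁻¹ *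
      ‖WithLp.toLp 2 (flowFactor P Δ Q *ᵥ w)‖ := by
  have hl := lambdaMin_pos hr hP'
  have hl₀ := lambdaMin_pos hr hΔ₀
  have h1 := lambdaMin_mul_norm_le hr hP' hD hQ hΔ hle w
  have h2 : lambdaMin Δ₀ * ‖WithLp.toLp 2 w‖ ≤ ‖WithLp.toLp 2 (Δ *ᵥ w)‖ := by
    have h3 := ((lambdaMin_spec hr hΔ₀.isHermitian).2 w).trans ((hle₀ w).trans
      (dotProduct_le_norm_mul_norm _ _))
    rcases (norm_nonneg (WithLp.toLp 2 w)).eq_or_lt with h0 | h0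
    · rw [← h0, mul_zero]
      exact norm_nonneg _
    · exact le_of_mul_le_mul_left (by linarith) h0
  rw [inv_mul_eq_div, le_div_iff₀ (by positivity)]
  nlinarith

lemma one_le_norm_inv_mul (hr : 1 ≤ r) (hP : P.PosDef) (hP' : (-P').PosDef) :
    (lambdaMin (-P'))⁻¹ ≤ ‖P'⁻¹‖ ∧ 1 ≤ ‖P'⁻¹‖ * ‖P - P'‖ := by
  have hl := lambdaMin_pos hr hP'
  have hinv : (lambdaMin (-P'))⁻¹ ≤ ‖P'⁻¹‖ := by
    have h1 : (-P')⁻¹ = -P'⁻¹ := by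
      have hu : IsUnit P'.det := by
        have := hP'.isUnit.neg
        rw [neg_neg] at this
        exact (isUnit_iff_isUnit_det _).1 this
      exact inv_eq_left_inv (by rw [neg_mul_neg, nonsing_inv_mul _ hu])
    simpa [h1] using inv_lambdaMin_le_norm_inv hr hP'
  refine ⟨hinv, ?_⟩
  obtain ⟨⟨v, hv, -⟩, h⟩ := lambdaMin_spec hr hP'.isHermitian
  have h1 := h v
  have h2 := dotProduct_le_norm_mul_sq (P - P') v
  have h3 := dotProduct_nonneg hP.posSemidef v
  rw [sub_mulVec, dotProduct_sub] at h2
  rw [neg_mulVec, dotProduct_neg] at h1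
  rw [hv] at h1 h2
  have h4 : lambdaMin (-P') ≤ ‖P - P'‖ := by linarith
  calc (1 : ℝ) = (lambdaMin (-P'))⁻¹ * lambdaMin (-P') := (inv_mul_cancel₀ hl.ne').symm
    _ ≤ _ := mul_le_mul hinv h4 hl.le (norm_nonneg _)

/-- Write `w = m - (Q - P) Δ w` with `m` its image and bound `Δ w` by `‖P'⁻¹‖ ‖m‖`. The coefficient
`1` of `‖m‖` is absorbed using `1 ≤ ‖P'⁻¹‖ ‖P - P'‖`. -/
lemma norm_le_chi_mul (hr : 1 ≤ r) (hP : P.PosDef) (hP' : (-P').PosDef)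
    (hQ : Q.PosSemidef) (hΔ : Δ.PosSemidef)
    (hle : ∀ v, v ⬝ᵥ (Δ *ᵥ v) ≤ v ⬝ᵥ ((P - P')⁻¹ *ᵥ v)) (w : Fin r → ℝ) :
    ‖WithLp.toLp 2 w‖ ≤ ‖P'⁻¹‖ * (‖P - P'‖ + ‖Q - P‖) *
      ‖WithLp.toLp 2 (flowFactor P Δ Q *ᵥ w)‖ := by
  have hD : (P - P').PosDef := by rw [sub_eq_add_neg]; exact hP.add hP'
  obtain ⟨hinv, hone⟩ := one_le_norm_inv_mul hr hP hP'
  have hl := lambdaMin_pos hr hP'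
  have h1 := lambdaMin_mul_norm_le hr hP' hD hQ hΔ hle w
  set m := flowFactor P Δ Q *ᵥ w with hm
  have h2 : ‖WithLp.toLp 2 (Δ *ᵥ w)‖ ≤ ‖P'⁻¹‖ * ‖WithLp.toLp 2 m‖ := by
    refine le_trans ?_ (mul_le_mul_of_nonneg_right hinv (norm_nonneg _))
    rwa [inv_mul_eq_div, le_div_iff₀ hl, mul_comm]
  have h3 : w = m - (Q - P) *ᵥ (Δ *ᵥ w) := by rw [hm, flowFactor_mulVec, add_sub_cancel_right]
  have h4 : ‖WithLp.toLp 2 w‖ ≤ ‖WithLp.toLp 2 m‖ + ‖Q - P‖ * ‖WithLp.toLp 2 (Δ *ᵥ w)‖ := by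
    conv_lhs => rw [h3, WithLp.toLp_sub]
    exact (norm_sub_le _ _).trans (add_le_add_right (norm_mulVec_le _ _) _)
  have h5 := mul_le_mul_of_nonneg_right hone (norm_nonneg (WithLp.toLp 2 m))
  have h6 := mul_le_mul_of_nonneg_left h2 (norm_nonneg (Q - P))
  linarith

lemma isUnit_flowFactor (hr : 1 ≤ r) (hP : P.PosDef) (hP' : (-P').PosDef)
    (hQ : Q.PosSemidef) (hΔ : Δ.PosSemidef)
    (hle : ∀ v, v ⬝ᵥ (Δ *ᵥ v) ≤ v ⬝ᵥ ((P - P')⁻¹ *ᵥ v)) : IsUnit (flowFactor P Δ Q) := by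
  rw [← mulVec_injective_iff_isUnit]
  refine (injective_iff_map_eq_zero (flowFactor P Δ Q).mulVecLin).2 fun v hv => ?_
  rw [mulVecLin_apply] at hv
  have h := norm_le_chi_mul hr hP hP' hQ hΔ hle v
  rw [hv, WithLp.toLp_zero, norm_zero, mul_zero] at h
  simpa using norm_le_zero_iff.1 h

/-- Lipschitz estimate for `(x, Q) ↦ U (I + (Q - P) Δ)⁻¹ x`. -/
lemma norm_flow_sub_le {U Q₁ Q₂ : Mat r} {c₁ c₂ e g : ℝ} (he : 0 ≤ e) (hc₂ : 0 ≤ c₂)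
    (hU : ‖U‖ ≤ e) (hg : ‖Δ‖ ≤ g)
    (h₁ : ∀ w, ‖WithLp.toLp 2 w‖ ≤ c₁ * ‖WithLp.toLp 2 (flowFactor P Δ Q₁ *ᵥ w)‖)
    (h₂ : ∀ w, ‖WithLp.toLp 2 w‖ ≤ c₂ * ‖WithLp.toLp 2 (flowFactor P Δ Q₂ *ᵥ w)‖)
    (hu₁ : IsUnit (flowFactor P Δ Q₁)) (hu₂ : IsUnit (flowFactor P Δ Q₂))
    (x₁ x₂ : EuclideanSpace ℝ (Fin r)) :
    ‖toEuclideanLin (U * (flowFactor P Δ Q₁)⁻¹) x₁ -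
        toEuclideanLin (U * (flowFactor P Δ Q₂)⁻¹) x₂‖ ≤
      e * c₂ * (c₁ * g * ‖x₁‖ * ‖Q₁ - Q₂‖ + ‖x₁ - x₂‖) := by
  set w₁ := (flowFactor P Δ Q₁)⁻¹ *ᵥ x₁.ofLp with hw₁
  set w₂ := (flowFactor P Δ Q₂)⁻¹ *ᵥ x₂.ofLp with hw₂
  have e₁ : flowFactor P Δ Q₁ *ᵥ w₁ = x₁.ofLp := by
    rw [hw₁, mulVec_mulVec, mul_nonsing_inv _ ((isUnit_iff_isUnit_det _).1 hu₁), one_mulVec]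
  have e₂ : flowFactor P Δ Q₂ *ᵥ w₂ = x₂.ofLp := by
    rw [hw₂, mulVec_mulVec, mul_nonsing_inv _ ((isUnit_iff_isUnit_det _).1 hu₂), one_mulVec]
  -- A resolvent identity: comparing the two preimages through the second factor makes the bound
  -- linear in `Q₁ - Q₂`.
  have e₃ : flowFactor P Δ Q₂ *ᵥ (w₁ - w₂) =
      (x₁ - x₂).ofLp - (Q₁ - Q₂) *ᵥ (Δ *ᵥ w₁) := by
    rw [mulVec_sub, e₂, WithLp.ofLp_sub, ← e₁, flowFactor_mulVec, flowFactor_mulVec]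
    simp only [sub_mulVec]
    abel
  have hlhs : toEuclideanLin (U * (flowFactor P Δ Q₁)⁻¹) x₁ -
      toEuclideanLin (U * (flowFactor P Δ Q₂)⁻¹) x₂ = WithLp.toLp 2 (U *ᵥ (w₁ - w₂)) := by
    rw [mulVec_sub, WithLp.toLp_sub, hw₁, hw₂, mulVec_mulVec, mulVec_mulVec]
    rfl
  have b₁ : ‖WithLp.toLp 2 w₁‖ ≤ c₁ * ‖x₁‖ := by simpa [e₁] using h₁ w₁
  have b₂ : ‖WithLp.toLp 2 ((Q₁ - Q₂) *ᵥ (Δ *ᵥ w₁))‖ ≤ ‖Q₁ - Q₂‖ * (g * (c₁ * ‖x₁‖)) := by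
    refine (norm_mulVec_le _ _).trans (mul_le_mul_of_nonneg_left ?_ (norm_nonneg _))
    exact (norm_mulVec_le _ _).trans (mul_le_mul hg b₁ (norm_nonneg _)
      ((norm_nonneg _).trans hg))
  have b₃ : ‖WithLp.toLp 2 (w₁ - w₂)‖ ≤
      c₂ * (‖x₁ - x₂‖ + ‖Q₁ - Q₂‖ * (g * (c₁ * ‖x₁‖))) := by
    refine (h₂ _).trans (mul_le_mul_of_nonneg_left ?_ hc₂)
    rw [e₃, WithLp.toLp_sub]
    exact (norm_sub_le _ _).trans (add_le_add_right b₂ _)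
  rw [hlhs]
  refine (norm_mulVec_le _ _).trans ((mul_le_mul hU b₃ (norm_nonneg _) he).trans_eq ?_)
  ring

end Factor

/-! ### Uniqueness for the Riccati, transition and mean equations -/

section Uniqueness

variable {A R S Q : Mat r} {φ : ℝ → Mat r}

lemma IsRiccatiSolution.continuousOn (h : IsRiccatiSolution A R S Q φ) :
    ContinuousOn φ (Ici 0) := fun t ht => (h.2 t ht).continuousWithinAt

lemma IsRiccatiSolution.eqOn {ψ : ℝ → Mat r} (hφ : IsRiccatiSolution A R S Q φ)
    (hψ : IsRiccatiSolution A R S Q ψ) : EqOn φ ψ (Ici 0) := by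
  intro t ht
  refine sub_eq_zero.1 (eq_zero_of_norm_deriv_le (f := fun t => φ t - ψ t)
    (k := fun t => ‖A - φ t * S‖ + ‖Aᵀ - S * ψ t‖) ?_
    (fun t ht => (hφ.2 t ht).sub (hψ.2 t ht)) (by simp [hφ.1, hψ.1]) (fun t _ => ?_) t ht)
  · exact (continuousOn_const.sub (hφ.continuousOn.mul continuousOn_const)).norm.add
      (continuousOn_const.sub (continuousOn_const.mul hψ.continuousOn)).norm
  -- The difference of two solutions obeys a linear equation with continuous coefficients, although
  -- the drift is quadratic.
  · have e : ricc A R S (φ t) - ricc A R S (ψ t) =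
        (A - φ t * S) * (φ t - ψ t) + (φ t - ψ t) * (Aᵀ - S * ψ t) := by
      rw [ricc, ricc]
      noncomm_ring
    rw [e]
    refine (norm_add_le _ _).trans ((add_le_add (norm_mul_le _ _) (norm_mul_le _ _)).trans_eq ?_)
    ring

lemma IsTransition.eqOn (hφ : ContinuousOn φ (Ici 0)) {E F : ℝ → Mat r}
    (hE : IsTransition A S φ E) (hF : IsTransition A S φ F) : EqOn E F (Ici 0) := by
  intro t ht
  refine sub_eq_zero.1 (eq_zero_of_norm_deriv_le (f := fun t => E t - F t)
    (k := fun t => ‖A - φ t * S‖) ?_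
    (fun t ht => (hE.2 t ht).sub (hF.2 t ht)) (by simp [hE.1, hF.1]) (fun t _ => ?_) t ht)
  · exact (continuousOn_const.sub (hφ.mul continuousOn_const)).norm
  · rw [← mul_sub]
    exact norm_mul_le _ _

lemma IsMeanSolution.eqOn (hφ : ContinuousOn φ (Ici 0)) {x : EuclideanSpace ℝ (Fin r)}
    {X Y : ℝ → EuclideanSpace ℝ (Fin r)}
    (hX : IsMeanSolution A S φ x X) (hY : IsMeanSolution A S φ x Y) : EqOn X Y (Ici 0) := by
  intro t ht
  refine sub_eq_zero.1 (eq_zero_of_norm_deriv_le (f := fun t => X t - Y t)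
    (k := fun t => ‖A - φ t * S‖) ?_
    (fun t ht => (hX.2 t ht).sub (hY.2 t ht)) (by simp [hX.1, hY.1]) (fun t _ => ?_) t ht)
  · exact (continuousOn_const.sub (hφ.mul continuousOn_const)).norm
  · rw [← map_sub]
    exact norm_mulVec_le _ _

lemma IsTransition.isMeanSolution {E : ℝ → Mat r} (hE : IsTransition A S φ E)
    (x : EuclideanSpace ℝ (Fin r)) :
    IsMeanSolution A S φ x fun t => toEuclideanLin (E t) x := by
  refine ⟨?_, fun t ht => ?_⟩
  · simp [hE.1]
  · refine (hasDerivWithinAt_toEuclideanLin (hE.2 t ht) x).congr_deriv ?_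
    simp [toLpLin_apply, mulVec_mulVec]

end Uniqueness

/-! ### Explicit form of the flows -/

section Explicit

variable {A R S P P' Q : Mat r}

/-- The Gramian `Δₜ` of the closed loop matrix `A - P S`. -/
noncomputable def gapGramian (A S P P' : Mat r) (t : ℝ) : Mat r :=
  lyapunovGramian (A - P * S) (P - P')⁻¹ t

/-- The transition matrices of the Riccati flow started at `Q`. -/
noncomputable def explicitTransition (A S P P' Q : Mat r) (t : ℝ) : Mat r :=
  NormedSpace.exp (t • (A - P * S)) * (flowFactor P (gapGramian A S P P' t) Q)⁻¹

/-- The Riccati flow started at `Q`. -/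
noncomputable def explicitRiccati (A S P P' Q : Mat r) (t : ℝ) : Mat r :=
  P + explicitTransition A S P P' Q t * (Q - P) * (NormedSpace.exp (t • (A - P * S)))ᵀ

lemma gapGramian_posSemidef (hS : S.PosSemidef) (hP : IsPosFixedPoint A R S P)
    (hP' : IsNegFixedPoint A R S P') {t : ℝ} (ht : 0 ≤ t) :
    (gapGramian A S P P' t).PosSemidef :=
  lyapunovGramian_posSemidef hS (hP.sub_posDef hP').inv (hP.lyapunov hS hP') ht

lemma dotProduct_gapGramian_le (hP : IsPosFixedPoint A R S P)
    (hP' : IsNegFixedPoint A R S P') (t : ℝ) (v : Fin r → ℝ) :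
    v ⬝ᵥ (gapGramian A S P P' t *ᵥ v) ≤ v ⬝ᵥ ((P - P')⁻¹ *ᵥ v) :=
  dotProduct_lyapunovGramian_le (hP.sub_posDef hP').inv t v

lemma isUnit_flowFactor_gapGramian (hr : 1 ≤ r) (hS : S.PosSemidef)
    (hP : IsPosFixedPoint A R S P) (hP' : IsNegFixedPoint A R S P') (hQ : Q.PosSemidef)
    {t : ℝ} (ht : 0 ≤ t) : IsUnit (flowFactor P (gapGramian A S P P' t) Q) :=
  isUnit_flowFactor hr hP.1 hP'.1 hQ (gapGramian_posSemidef hS hP hP' ht)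
    (dotProduct_gapGramian_le hP hP' t)

lemma explicitTransition_zero : explicitTransition A S P P' Q 0 = 1 := by
  simp [explicitTransition, gapGramian, lyapunovGramian_zero, flowFactor]

/-- The factor `M` has derivative `(Q - P) e^{tBᵀ} S e^{tB}`, so differentiating `M⁻¹` contributes
`-(φ - P) S E`, which completes `B E` to `(A - φ S) E`. -/
lemma hasDerivAt_explicitTransition (hr : 1 ≤ r) (hS : S.PosSemidef)
    (hP : IsPosFixedPoint A R S P) (hP' : IsNegFixedPoint A R S P') (hQ : Q.PosSemidef)
    {t : ℝ} (ht : 0 ≤ t) : HasDerivAt (explicitTransition A S P P' Q)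
      ((A - explicitRiccati A S P P' Q t * S) * explicitTransition A S P P' Q t) t := by
  have hM : HasDerivAt (fun t => flowFactor P (gapGramian A S P P' t) Q) _ t :=
    ((hasDerivAt_lyapunovGramian (hP.lyapunov hS hP') t).const_mul (Q - P)).const_add 1
  have h := (hasDerivAt_exp_smul (A - P * S) t).mul
    (hasDerivAt_matrix_inv hM (isUnit_flowFactor_gapGramian hr hS hP hP' hQ ht))
  refine h.congr_deriv ?_
  rw [explicitRiccati, explicitTransition]
  noncomm_ring

lemma isTransition_explicit (hr : 1 ≤ r) (hS : S.PosSemidef)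
    (hP : IsPosFixedPoint A R S P) (hP' : IsNegFixedPoint A R S P') (hQ : Q.PosSemidef) :
    IsTransition A S (explicitRiccati A S P P' Q) (explicitTransition A S P P' Q) :=
  ⟨explicitTransition_zero, fun _ ht =>
    (hasDerivAt_explicitTransition hr hS hP hP' hQ ht).hasDerivWithinAt⟩

lemma isRiccatiSolution_explicit (hr : 1 ≤ r) (hS : S.PosSemidef)
    (hP : IsPosFixedPoint A R S P) (hP' : IsNegFixedPoint A R S P') (hQ : Q.PosSemidef) :
    IsRiccatiSolution A R S Q (explicitRiccati A S P P' Q) := by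
  refine ⟨by simp [explicitRiccati, explicitTransition_zero], fun t ht => ?_⟩
  have h := ((((hasDerivAt_explicitTransition hr hS hP hP' hQ ht).mul_const (Q - P)).mul
    (hasDerivAt_transpose (hasDerivAt_exp_smul (A - P * S) t))).const_add P).hasDerivWithinAt
    (s := Ici 0)
  refine h.congr_deriv ?_
  set K := explicitTransition A S P P' Q t * (Q - P) * (NormedSpace.exp (t • (A - P * S)))ᵀ
    with hK
  have hφ : explicitRiccati A S P P' Q t = P + K := rfl
  -- Expansion of the drift around the fixed point; the bracket is exactly the derivative of `K`.
  have e1 : ricc A R S (P + K) =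
      ricc A R S P + ((A - (P + K) * S) * K + K * (Aᵀ - S * P)) := by
    rw [ricc, ricc]
    noncomm_ring
  rw [hφ, e1, hP.2, zero_add, transpose_mul, transpose_sub, transpose_mul,
    transpose_eq_of_posSemidef hS, transpose_eq_of_posSemidef hP.1.posSemidef, ← mul_assoc,
    ← hK, mul_assoc (A - (P + K) * S), mul_assoc (A - (P + K) * S), ← hK]

/-! ### Identification of the chosen flows with the explicit ones -/

lemma explicitTransition_self (t : ℝ) :
    explicitTransition A S P P' P t = NormedSpace.exp (t • (A - P * S)) := by
  simp [explicitTransition, flowFactor]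

lemma isRiccatiSolution_riccatiFlow (hr : 1 ≤ r) (hS : S.PosSemidef)
    (hP : IsPosFixedPoint A R S P) (hP' : IsNegFixedPoint A R S P') (hQ : Q.PosSemidef) :
    IsRiccatiSolution A R S Q (riccatiFlow A R S Q) :=
  Classical.epsilon_spec ⟨_, isRiccatiSolution_explicit hr hS hP hP' hQ⟩

lemma isTransition_riccatiFlow (hr : 1 ≤ r) (hS : S.PosSemidef)
    (hP : IsPosFixedPoint A R S P) (hP' : IsNegFixedPoint A R S P') (hQ : Q.PosSemidef) :
    IsTransition A S (riccatiFlow A R S Q) (explicitTransition A S P P' Q) := by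
  have h := isTransition_explicit hr hS hP hP' hQ
  refine ⟨h.1, fun t ht => ?_⟩
  rw [(isRiccatiSolution_riccatiFlow hr hS hP hP' hQ).eqOn
    (isRiccatiSolution_explicit hr hS hP hP' hQ) ht]
  exact h.2 t ht

lemma isTransition_transition (hr : 1 ≤ r) (hS : S.PosSemidef)
    (hP : IsPosFixedPoint A R S P) (hP' : IsNegFixedPoint A R S P') (hQ : Q.PosSemidef) :
    IsTransition A S (riccatiFlow A R S Q) (transition A R S Q) :=
  Classical.epsilon_spec ⟨_, isTransition_riccatiFlow hr hS hP hP' hQ⟩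

lemma transition_eq_explicit (hr : 1 ≤ r) (hS : S.PosSemidef)
    (hP : IsPosFixedPoint A R S P) (hP' : IsNegFixedPoint A R S P') (hQ : Q.PosSemidef)
    {t : ℝ} (ht : 0 ≤ t) : transition A R S Q t = explicitTransition A S P P' Q t :=
  (isTransition_transition hr hS hP hP' hQ).eqOn
    (isRiccatiSolution_riccatiFlow hr hS hP hP' hQ).continuousOn
    (isTransition_riccatiFlow hr hS hP hP' hQ) ht

lemma gramianIntegrand_eq (s : ℝ) : gramianIntegrand A R S s =
    (NormedSpace.exp (s • (A - posFixedPoint A R S * S)))ᵀ * S *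
      NormedSpace.exp (s • (A - posFixedPoint A R S * S)) := by
  rw [gramianIntegrand, ← exp_transpose, transpose_smul]

end Explicit

end RiccatiMeanFlow

/-! ### Assembly of the theorem -/

theorem mainTheorem12 (r : ℕ) (hr : 1 ≤ r) (A R S Rh Sh : Mat r)
    (hR : R.PosSemidef) (hS : S.PosSemidef)
    (hRh : Rh.IsSymm) (hRR : Rh * Rh = R) (hSh : Sh.IsSymm) (hSS : Sh * Sh = S)
    (hAR : IsControllable A Rh) (hAS : IsControllable A.transpose Sh) :
    -- existence and uniqueness of the positive and of the negative fixed point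
    (IsPosFixedPoint A R S (posFixedPoint A R S) ∧
      ∀ P : Mat r, IsPosFixedPoint A R S P → P = posFixedPoint A R S) ∧
    (IsNegFixedPoint A R S (negFixedPoint A R S) ∧
      ∀ P : Mat r, IsNegFixedPoint A R S P → P = negFixedPoint A R S) ∧
    -- the flows are well defined for all nonnegative times
    (∀ Q : Mat r, Q.PosSemidef →
      (IsRiccatiSolution A R S Q (riccatiFlow A R S Q) ∧
        ∀ φ : ℝ → Mat r, IsRiccatiSolution A R S Q φ →
          Set.EqOn φ (riccatiFlow A R S Q) (Set.Ici 0)) ∧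
      (IsTransition A S (riccatiFlow A R S Q) (transition A R S Q) ∧
        ∀ E : ℝ → Mat r, IsTransition A S (riccatiFlow A R S Q) E →
          Set.EqOn E (transition A R S Q) (Set.Ici 0)) ∧
      (∀ x : EuclideanSpace ℝ (Fin r),
        IsMeanSolution A S (riccatiFlow A R S Q) x (fun t => meanFlow A R S t x Q) ∧
        ∀ X : ℝ → EuclideanSpace ℝ (Fin r), IsMeanSolution A S (riccatiFlow A R S Q) x X →
          Set.EqOn X (fun t => meanFlow A R S t x Q) (Set.Ici 0))) ∧
    -- the constants are well defined
    MeasureTheory.IntegrableOn (gramianIntegrand A R S) (Set.Ioi (0 : ℝ)) ∧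
    (∀ δ : ℝ, 0 < δ →
      0 < lambdaMin (gramian A R S δ) ∧ 0 < lambdaMin (-negFixedPoint A R S)) ∧
    (∃ α β : ℝ, 0 < α ∧ 0 < β ∧ ∀ t : ℝ, 0 ≤ t →
      ‖transition A R S (posFixedPoint A R S) t‖ ≤ α * Real.exp (-β * t)) ∧
    -- the two Lipschitz estimates
    ∀ α β : ℝ, 0 < α → 0 < β →
      (∀ t : ℝ, 0 ≤ t →
        ‖transition A R S (posFixedPoint A R S) t‖ ≤ α * Real.exp (-β * t)) →
      (∀ δ t : ℝ, 0 < δ → δ ≤ t →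
        ∀ Q₁ Q₂ : Mat r, Q₁.PosSemidef → Q₂.PosSemidef →
        ∀ x₁ x₂ : EuclideanSpace ℝ (Fin r),
          ‖meanFlow A R S t x₁ Q₁ - meanFlow A R S t x₂ Q₂‖ ≤
            α * chiDelta A R S δ * Real.exp (-β * t) *
              (chiDelta A R S δ * ‖gramianInf A R S‖ * ‖x₁‖ * ‖Q₁ - Q₂‖ + ‖x₁ - x₂‖)) ∧
      (∀ t : ℝ, 0 ≤ t →
        ∀ Q₁ Q₂ : Mat r, Q₁.PosSemidef → Q₂.PosSemidef →
        ∀ x₁ x₂ : EuclideanSpace ℝ (Fin r),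
          ‖meanFlow A R S t x₁ Q₁ - meanFlow A R S t x₂ Q₂‖ ≤
            α * chi A R S Q₂ * Real.exp (-β * t) *
              (chi A R S Q₁ * ‖gramianInf A R S‖ * ‖x₁‖ * ‖Q₁ - Q₂‖ + ‖x₁ - x₂‖)) := by
  have oR : IsObservable A.transpose R :=
    IsControllable.isObservable hRh hRR (by rwa [Matrix.transpose_transpose])
  have oS : IsObservable A S := hAS.isObservable hSh hSS
  have hP : IsPosFixedPoint A R S (posFixedPoint A R S) :=
    Classical.epsilon_spec (exists_isPosFixedPoint hR hS oR oS)
  have hP' : IsNegFixedPoint A R S (negFixedPoint A R S) :=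
    Classical.epsilon_spec (exists_isNegFixedPoint hR hS oR oS)
  set P := posFixedPoint A R S with hPdef
  set P' := negFixedPoint A R S with hPdef'
  have hL := hP.lyapunov hS hP'
  have hG := (hP.sub_posDef hP').inv
  have hexp : ∀ t : ℝ, 0 ≤ t →
      transition A R S P t = NormedSpace.exp (t • (A - P * S)) := fun t ht => by
    rw [transition_eq_explicit hr hS hP hP' hP.1.posSemidef ht, explicitTransition_self]
  have hint : gramianIntegrand A R S = fun s => (NormedSpace.exp (s • (A - P * S))).transpose *
      S * NormedSpace.exp (s • (A - P * S)) := funext gramianIntegrand_eq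
  have hgram : ∀ t, gramian A R S t = gapGramian A S P P' t := fun t => by
    rw [gramian, hint]
    exact intervalIntegral_conj_exp hL t
  have hgramPos : ∀ δ, 0 < δ → (gapGramian A S P P' δ).PosDef := fun δ hδ =>
    lyapunovGramian_posDef hS hG hL (oS.sub_mul P) hδ
  -- These constants serve convergence and existence only; the Lipschitz estimates use arbitrary
  -- `α`, `β` satisfying the decay bound.
  obtain ⟨α₀, β₀, hα₀, hβ₀, hdecay⟩ := hP.exists_exp_decay hr hS oS hP'
  have hgramInf : gramianInf A R S = (P - P')⁻¹ := by
    rw [gramianInf, hint]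
    exact integral_Ioi_conj_exp hL hβ₀ hdecay
  refine ⟨⟨hP, fun P₁ h₁ => h₁.eq hr hR hS oR oS hP⟩,
    ⟨hP', fun P₁ h₁ => h₁.eq hr hR hS oR oS hP'⟩, fun Q hQ => ?_, ?_, fun δ hδ => ?_,
    ⟨α₀, β₀, hα₀, hβ₀, fun t ht => by rw [hexp t ht]; exact hdecay t ht⟩,
    fun α β hα hβ hαβ => ?_⟩
  · have hφ := isRiccatiSolution_riccatiFlow hr hS hP hP' hQ
    have hE := isTransition_transition hr hS hP hP' hQ
    exact ⟨⟨hφ, fun φ h => h.eqOn hφ⟩, ⟨hE, fun E h => h.eqOn hφ.continuousOn hE⟩,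
      fun x => ⟨hE.isMeanSolution x, fun X h => h.eqOn hφ.continuousOn (hE.isMeanSolution x)⟩⟩
  · rw [hint]
    exact integrableOn_conj_exp hβ₀ hdecay
  · rw [hgram]
    exact ⟨lambdaMin_pos hr (hgramPos δ hδ), lambdaMin_pos hr hP'.1⟩
  -- Both estimates are instances of one bound, with `c₁`, `c₂` controlling the inverses of the two
  -- flow factors.
  · have main : ∀ t : ℝ, 0 ≤ t → ∀ Q₁ Q₂ : Mat r, Q₁.PosSemidef → Q₂.PosSemidef →
        ∀ c₁ c₂ : ℝ, 0 ≤ c₂ →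
        (∀ w, ‖WithLp.toLp 2 w‖ ≤ c₁ *
          ‖WithLp.toLp 2 ((flowFactor P (gapGramian A S P P' t) Q₁).mulVec w)‖) →
        (∀ w, ‖WithLp.toLp 2 w‖ ≤ c₂ *
          ‖WithLp.toLp 2 ((flowFactor P (gapGramian A S P P' t) Q₂).mulVec w)‖) →
        ∀ x₁ x₂ : EuclideanSpace ℝ (Fin r),
          ‖meanFlow A R S t x₁ Q₁ - meanFlow A R S t x₂ Q₂‖ ≤
            α * c₂ * Real.exp (-β * t) *
              (c₁ * ‖gramianInf A R S‖ * ‖x₁‖ * ‖Q₁ - Q₂‖ + ‖x₁ - x₂‖) := by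
      intro t ht Q₁ Q₂ hQ₁ hQ₂ c₁ c₂ hc₂ h₁ h₂ x₁ x₂
      have hg : ‖gapGramian A S P P' t‖ ≤ ‖gramianInf A R S‖ := by
        rw [hgramInf]
        exact norm_le_norm_of_posSemidef (gapGramian_posSemidef hS hP hP' ht)
          (dotProduct_gapGramian_le hP hP' t)
      have hU := hαβ t ht
      rw [hexp t ht] at hU
      rw [meanFlow, meanFlow, transition_eq_explicit hr hS hP hP' hQ₁ ht,
        transition_eq_explicit hr hS hP hP' hQ₂ ht]
      refine (norm_flow_sub_le (by positivity) hc₂ hU hg h₁ h₂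
        (isUnit_flowFactor_gapGramian hr hS hP hP' hQ₁ ht)
        (isUnit_flowFactor_gapGramian hr hS hP hP' hQ₂ ht) x₁ x₂).trans_eq ?_
      ring
    constructor
    · intro δ t hδ hδt Q₁ Q₂ hQ₁ hQ₂
      have ht : 0 ≤ t := hδ.le.trans hδt
      have hχ : chiDelta A R S δ =
          (lambdaMin (gapGramian A S P P' δ) * lambdaMin (-P'))⁻¹ := by
        rw [chiDelta, hgram]
      have hc : 0 ≤ chiDelta A R S δ := by
        rw [hχ]
        exact inv_nonneg.2 (mul_pos (lambdaMin_pos hr (hgramPos δ hδ))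
          (lambdaMin_pos hr hP'.1)).le
      have hb : ∀ Q : Mat r, Q.PosSemidef → ∀ w, ‖WithLp.toLp 2 w‖ ≤ chiDelta A R S δ *
          ‖WithLp.toLp 2 ((flowFactor P (gapGramian A S P P' t) Q).mulVec w)‖ := fun Q hQ => by
        rw [hχ]
        -- Monotonicity of the Gramian, `Δ_δ ≤ Δₜ` for `δ ≤ t`, makes the constant uniform in `t`.
        exact norm_le_lambdaMin_mul hr hP'.1 (hP.sub_posDef hP') hQ
          (gapGramian_posSemidef hS hP hP' ht) (dotProduct_gapGramian_le hP hP' t)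
          (hgramPos δ hδ) fun v => monotone_lyapunovGramian hS hL v hδt
      exact main t ht Q₁ Q₂ hQ₁ hQ₂ _ _ hc (hb Q₁ hQ₁) (hb Q₂ hQ₂)
    · intro t ht Q₁ Q₂ hQ₁ hQ₂
      have hb : ∀ Q : Mat r, Q.PosSemidef → 0 ≤ chi A R S Q ∧ ∀ w, ‖WithLp.toLp 2 w‖ ≤
          chi A R S Q *
            ‖WithLp.toLp 2 ((flowFactor P (gapGramian A S P P' t) Q).mulVec w)‖ :=
        fun Q hQ => ⟨by unfold chi; positivity, norm_le_chi_mul hr hP.1 hP'.1 hQ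
          (gapGramian_posSemidef hS hP hP' ht) (dotProduct_gapGramian_le hP hP' t)⟩
      exact main t ht Q₁ Q₂ hQ₁ hQ₂ _ _ (hb Q₂ hQ₂).1 (hb Q₁ hQ₁).2 (hb Q₂ hQ₂).2
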